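/- A radial weight is a nonnegative function $\omega\in L^1([0,1))$, extended to the unit disc $\mathbb{D}$ by $\omega(z)=\omega(|z|)$, with $\widehat{\omega}(z)=\widehat{\omega}(|z|)=\int_{|z|}^1\omega(s)\,ds>0$ for all $z\in\mathbb{D}$. Write $\omega\in\widehat{\mathcal D}$ if there is $C>0$ such that $\widehat{\omega}(r)\le C\,\widehat{\omega}\left(\frac{1+r}{2}\right)$ for all $r<1$ close enough to $1$, and $\omega\in\widecheck{\mathcal D}$ if there are $K>1$ and $C>1$ such that $\widehat{\omega}(r)\ge C\,\widehat{\omega}\left(1-\frac{1-r}{K}\right)$ for all $r<1$ close enough to $1$. Let $dA=\frac{dx\,dy}{\pi}$ on $\mathbb{D}$, let $A^2_\omega$ be the space of analytic $f$ on $\mathbb{D}$ with $\int_{\mathbb{D}}|f|^2\omega\,dA<\infty$, let $B^\omega_z$ be its reproducing kernels, and let $$P_\omega f(z)=\int_{\mathbb{D}}f(\zeta)\overline{B^\omega_z(\zeta)}\,\omega(\zeta)\,dA(\zeta),\qquad z\in\mathbb{D},$$ whenever the integral converges absolutely for every $z\in\mathbb{D}$. For a radial weight $\nu$, let $L^\infty_{\widehat\nu}$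 be the space of measurable $f$ on $\mathbb{D}$ with $\|f\|_{\infty,\widehat\nu}=\operatorname{ess\,sup}_{z\in\mathbb{D}}|f(z)|\,\widehat\nu(z)<\infty$, let $H^\infty_{\widehat\nu}$ be the space of analytic functions in $L^\infty_{\widehat\nu}$, and let $\mathcal{B}^\infty_{\widehat\nu}$ be the space of analytic $f$ on $\mathbb{D}$ with $\|f\|_{\mathcal{B}^\infty_{\widehat\nu}}=\sup_{z\in\mathbb{D}}(1-|z|)\,\widehat\nu(z)\,|f'(z)|<\infty$. Let $\omega$ be a radial weight with $\omega\in\widehat{\mathcal D}\setminus\widecheck{\mathcal D}$. (1) For every radial weight $\nu$, $P_\omega$ is not bounded from $L^\infty_{\widehat\nu}$ to $H^\infty_{\widehat\nu}$; indeed there is no constant $C$ such that $P_\omega f\in H^\infty_{\widehat\nu}$ and $\|P_\omega f\|_{\infty,\widehat\nu}\le C\|f\|_{\infty,\widehat\nu}$ for all those $f\in L^\infty_{\widehat\nu}$ for which $P_\omega f$ is defined. (2) There exists a radial weight $\nu_\omega$ with $\widehat{\nu_\omega}\asymp\widehat{\omega}^{1/2}$ on $[0,1)$, that is, with $c\,\widehat{\omega}(r)^{1/2}\le\widehat{\nu_\omega}(r)\le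 C\,\widehat{\omega}(r)^{1/2}$ for all $r\in[0,1)$ and some constants $c,C>0$. For every such $\nu_\omega$, the projection $P_\omega:L^\infty_{\widehat{\nu_\omega}}\to\mathcal{B}^\infty_{\widehat{\nu_\omega}}$ is bounded: there is a constant $C'$ such that, for every $f\in L^\infty_{\widehat{\nu_\omega}}$, $P_\omega f$ is defined, belongs to $\mathcal{B}^\infty_{\widehat{\nu_\omega}}$, and satisfies $\|P_\omega f\|_{\mathcal{B}^\infty_{\widehat{\nu_\omega}}}\le C'\|f\|_{\infty,\widehat{\nu_\omega}}$. -/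

import Mathlib

open MeasureTheory Filter Topology Set
open scoped NNReal ENNReal ComplexConjugate

noncomputable section

/-- The tail integral `ω̂(r) = ∫_r^1 ω(s) ds`. -/
def tail (ω : ℝ → ℝ) (r : ℝ) : ℝ := ∫ s in r..1, ω s

/-- A radial weight, given by its radial profile on `[0, 1)`: nonnegative, integrable, and with
positive tail integrals. Its extension to the disc is `z ↦ ω ‖z‖`. -/
structure IsRadialWeight (ω : ℝ → ℝ) : Prop where
  nonneg : ∀ r ∈ Ico (0 : ℝ) 1, 0 ≤ ω r
  integrable : IntegrableOn ω (Ico (0 : ℝ) 1)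
  tail_pos : ∀ r ∈ Ico (0 : ℝ) 1, 0 < tail ω r

/-- The upper doubling condition. -/
def UpperDoubling (ω : ℝ → ℝ) : Prop :=
  ∃ C : ℝ, 0 < C ∧ ∀ᶠ r in 𝓝[<] (1 : ℝ), tail ω r ≤ C * tail ω ((1 + r) / 2)

/-- The lower doubling condition. -/
def LowerDoubling (ω : ℝ → ℝ) : Prop :=
  ∃ K C : ℝ, 1 < K ∧ 1 < C ∧
    ∀ᶠ r in 𝓝[<] (1 : ℝ), C * tail ω (1 - (1 - r) / K) ≤ tail ω r

/-- The open unit disc. -/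
def disc : Set ℂ := Metric.ball 0 1

/-- The normalized area measure `dA = dx dy / π` on the disc. -/
def dA : Measure ℂ := ENNReal.ofReal (Real.pi⁻¹) • volume.restrict disc

/-- Membership in the weighted Bergman space `A²_ω`. -/
def MemBergman (ω : ℝ → ℝ) (f : ℂ → ℂ) : Prop :=
  DifferentiableOn ℂ f disc ∧ Integrable (fun ζ => ‖f ζ‖ ^ 2 * ω ‖ζ‖) dA

/-- `K z` is the reproducing kernel of `A²_ω` at `z`, for every `z` in the disc. -/
def IsReproducingKernel (ω : ℝ → ℝ) (K : ℂ → ℂ → ℂ) : Prop :=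
  ∀ z ∈ disc, MemBergman ω (K z) ∧
    ∀ f : ℂ → ℂ, MemBergman ω f → f z = ∫ ζ, f ζ * conj (K z ζ) * (ω ‖ζ‖ : ℂ) ∂dA

open Classical in
/-- The Bergman kernel `(z, ζ) ↦ B_z^ω(ζ)`: the reproducing kernel of `A²_ω`. It exists for every
radial weight, and its values on the disc are unique. -/
def bergmanKernel (ω : ℝ → ℝ) : ℂ → ℂ → ℂ :=
  if h : ∃ K, IsReproducingKernel ω K then h.choose else fun _ _ => 0

/-- The integrand of the Bergman projection `P_ω f (z)`. -/
def bergmanIntegrand (ω : ℝ → ℝ) (f : ℂ → ℂ) (z ζ : ℂ) : ℂ :=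
  f ζ * conj (bergmanKernel ω z ζ) * (ω ‖ζ‖ : ℂ)

/-- `P_ω f` is defined: the integral converges absolutely at every point of the disc. -/
def BergmanDefined (ω : ℝ → ℝ) (f : ℂ → ℂ) : Prop :=
  ∀ z ∈ disc, Integrable (bergmanIntegrand ω f z) dA

/-- The Bergman projection `P_ω`. -/
def bergmanProj (ω : ℝ → ℝ) (f : ℂ → ℂ) (z : ℂ) : ℂ := ∫ ζ, bergmanIntegrand ω f z ζ ∂dA

/-- The norm `ess sup |f(z)| v(|z|)` over the disc. -/
def growthNorm (v : ℝ → ℝ) (f : ℂ → ℂ) : ℝ≥0∞ :=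
  essSup (fun z => ENNReal.ofReal (‖f z‖ * v ‖z‖)) dA

/-- Membership in the growth space `L^∞_v`. -/
def MemGrowth (v : ℝ → ℝ) (f : ℂ → ℂ) : Prop :=
  AEStronglyMeasurable f dA ∧ growthNorm v f < ∞

/-- Membership in `H^∞_v`, the analytic functions in `L^∞_v`. -/
def MemHardy (v : ℝ → ℝ) (f : ℂ → ℂ) : Prop :=
  DifferentiableOn ℂ f disc ∧ growthNorm v f < ∞

/-- The quantity `sup (1 - |z|) v(|z|) |f'(z)|` over the disc. -/
def blochNorm (v : ℝ → ℝ) (f : ℂ → ℂ) : ℝ≥0∞ :=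
  ⨆ z ∈ disc, ENNReal.ofReal ((1 - ‖z‖) * v ‖z‖ * ‖deriv f z‖)

/-- Membership in the Bloch type space `B^∞_v`. -/
def MemBloch (v : ℝ → ℝ) (f : ℂ → ℂ) : Prop :=
  DifferentiableOn ℂ f disc ∧ blochNorm v f < ∞

/-- `P_ω` is bounded from its natural domain in `L^∞_v` to `H^∞_v`. The natural domain consists of
the functions in `L^∞_v` for which the integral converges absolutely; it is not required here to be
the whole of `L^∞_v`, so that the negation is stronger than unboundedness on `L^∞_v`. -/
def BergmanBoundedOnDomainToHardy (ω v : ℝ → ℝ) : Prop :=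
  ∃ C : ℝ≥0, ∀ f : ℂ → ℂ, MemGrowth v f → BergmanDefined ω f →
    MemHardy v (bergmanProj ω f) ∧ growthNorm v (bergmanProj ω f) ≤ C * growthNorm v f

/-- `P_ω` is defined on the whole of `L^∞_v`, and bounded from `L^∞_v` to `B^∞_v`. -/
def BergmanBoundedToBloch (ω v : ℝ → ℝ) : Prop :=
  ∃ C : ℝ≥0, ∀ f : ℂ → ℂ, MemGrowth v f →
    BergmanDefined ω f ∧ MemBloch v (bergmanProj ω f) ∧
      blochNorm v (bergmanProj ω f) ≤ C * growthNorm v f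

/-- `ν̂ ≍ ω̂^{1/2}` on `[0, 1)`. -/
def TailComparableSqrt (ν ω : ℝ → ℝ) : Prop :=
  ∃ c C : ℝ, 0 < c ∧ 0 < C ∧ ∀ r ∈ Ico (0 : ℝ) 1,
    c * Real.sqrt (tail ω r) ≤ tail ν r ∧ tail ν r ≤ C * Real.sqrt (tail ω r)

end

/-! Write `ω̂` for `tail ω` and `ω_k` for the moment `∫ r^k ω`. Orthogonality of the monomials gives
`conj (B_z(ζ)) = Φ(z * conj ζ)` with `Φ(w) = ∑ w^n / (2 ω_{2n+1})`, so everything reduces to the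
size of the moments. Upper doubling supplies two facts: `ω_n ≲ ω̂(1 - 1/n)`
(`exists_radialMoment_le`) and `n (ω_{2n+1} - ω_{2n+3}) ≲ ω_{2n+1}`.

Unboundedness. The test function `arg ζ * conj ζ / ν̂(s)`, cut off to `|ζ| ≥ s`, has norm at most
`π`. The Fourier coefficients of the sawtooth `θ` decay only like `1/m` and alternate in sign, so at
the point `-s` all terms of its projection have the same phase. The factors `ν̂(s)` cancel, and
boundedness for a single `ν` forces `ω̂(s) ∑ s^(2n+2) / ((n+1) ω_{2n+1}) ≤ A` uniformly in `s`. For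
`s = 1 - (1-r)/2^J`, the indices `n` between about `1/(1-r)` and `2^J/(1-r)` contribute at least a
constant times `J / ω̂(r)`. A large `J` then gives `2 ω̂(s) ≤ ω̂(r)`, which is lower doubling
(`lowerDoubling_of_tail_mul_sum_le`).

Bloch bound. The coefficients of `(1-w) Φ'(w)` are comparable to those of `Φ`, so Parseval for
`(1-w) Φ'` and for `1/(1-w)`, with a Cauchy-Schwarz argument, bounds the integral means of `Φ'` on
`|w| = x` by a constant times `1 / ((1-x) ω̂(x))`. If `|f| ≲ ω̂^(-1/2)`, differentiating under the
integral bounds `|(P_ω f)'(z)|` by `(1-|z|)⁻¹ ∫ ω ω̂^(-1/2) / max(ω̂, ω̂(|z|)) dr`. The substitution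
`u = ω̂(r)` makes this an explicit integral of size `ω̂(|z|)^(-1/2)`. The power `1/2` makes both
pieces, `u < ω̂(|z|)` and `u > ω̂(|z|)`, converge.

The companion weight is minus the derivative of the average of `√ω̂` over `[r, 1]`. Unlike `√ω̂`,
this average is differentiable at every interior point. -/

namespace IsRadialWeight

variable {ω : ℝ → ℝ}

/-! ### Tail integrals and upper doubling. -/

theorem intervalIntegrable (hω : IsRadialWeight ω) {a b : ℝ} (ha : a ∈ Icc (0 : ℝ) 1)
    (hb : b ∈ Icc (0 : ℝ) 1) : IntervalIntegrable ω volume a b := by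
  have h : IntervalIntegrable ω volume 0 1 := by
    rw [intervalIntegrable_iff_integrableOn_Ico_of_le zero_le_one]
    exact hω.integrable
  refine h.mono_set ?_
  rw [uIcc_of_le (zero_le_one' ℝ)]
  exact uIcc_subset_Icc ha hb

theorem integrableOn_Ioo (hω : IsRadialWeight ω) : IntegrableOn ω (Ioo 0 1) :=
  hω.integrable.mono_set Ioo_subset_Ico_self

theorem tail_sub (hω : IsRadialWeight ω) {a b : ℝ} (ha : a ∈ Icc (0 : ℝ) 1)
    (hb : b ∈ Icc (0 : ℝ) 1) : tail ω a - tail ω b = ∫ s in a..b, ω s := by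
  have h1 : (1 : ℝ) ∈ Icc (0 : ℝ) 1 := by simp
  have := intervalIntegral.integral_add_adjacent_intervals (hω.intervalIntegrable ha hb)
    (hω.intervalIntegrable hb h1)
  unfold tail
  linarith

theorem tail_anti (hω : IsRadialWeight ω) {a b : ℝ} (ha : 0 ≤ a) (hab : a ≤ b) (hb : b ≤ 1) :
    tail ω b ≤ tail ω a := by
  have h := hω.tail_sub (a := a) (b := b) ⟨ha, hab.trans hb⟩ ⟨ha.trans hab, hb⟩
  have : 0 ≤ ∫ s in a..b, ω s := by
    rw [intervalIntegral.integral_of_le hab, integral_Ioc_eq_integral_Ioo]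
    exact setIntegral_nonneg measurableSet_Ioo fun x hx =>
      hω.nonneg x ⟨ha.trans hx.1.le, hx.2.trans_le hb⟩
  linarith

theorem continuousOn_tail (hω : IsRadialWeight ω) : ContinuousOn (tail ω) (Icc 0 1) := by
  have := intervalIntegral.continuousOn_primitive_interval_left (f := ω) (μ := volume) (a := 0)
    (b := 1) (by rw [uIcc_of_le zero_le_one, integrableOn_Icc_iff_integrableOn_Ico]
                 exact hω.integrable)
  rwa [uIcc_of_le (zero_le_one' ℝ)] at this

theorem _root_.tail_one (ω : ℝ → ℝ) : tail ω 1 = 0 := by simp [tail]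

/-- The doubling condition near `1` holds on all of `[0, 1)` with another constant. -/
theorem exists_doubling (hω : IsRadialWeight ω) (hup : UpperDoubling ω) :
    ∃ C : ℝ, 1 ≤ C ∧ ∀ r ∈ Ico (0 : ℝ) 1, tail ω r ≤ C * tail ω ((1 + r) / 2) := by
  obtain ⟨C, hC, h⟩ := hup
  obtain ⟨l, hl, hlC⟩ := (mem_nhdsLT_iff_exists_Ioo_subset.1 h)
  simp only [mem_Iio] at hl
  set m := max l 0 with hm
  have hm1 : m < 1 := max_lt hl one_pos
  have hm0 : 0 ≤ m := le_max_right _ _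
  have hpos : 0 < tail ω ((1 + m) / 2) := hω.tail_pos _ ⟨by linarith, by linarith⟩
  refine ⟨max (max C 1) (tail ω 0 / tail ω ((1 + m) / 2)),
    (le_max_right _ _).trans (le_max_left _ _), fun r hr => ?_⟩
  have hr' : 0 < tail ω ((1 + r) / 2) :=
    hω.tail_pos _ ⟨by linarith [hr.1], by linarith [hr.2]⟩
  rcases lt_or_ge m r with hmr | hmr
  · refine (hlC ⟨(le_max_left _ _).trans_lt hmr, hr.2⟩ : _ ≤ _).trans ?_
    gcongr
    exact (le_max_left _ _).trans (le_max_left _ _)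
  -- Away from `1` the quotient of tails is bounded by monotonicity alone.
  · calc tail ω r ≤ tail ω 0 := hω.tail_anti le_rfl hr.1 hr.2.le
      _ = tail ω 0 / tail ω ((1 + m) / 2) * tail ω ((1 + m) / 2) := by field_simp
      _ ≤ tail ω 0 / tail ω ((1 + m) / 2) * tail ω ((1 + r) / 2) := by
        have := (hω.tail_pos 0 (by simp)).le
        gcongr
        exact hω.tail_anti (by linarith [hr.1]) (by linarith) (by linarith [hr.2])
      _ ≤ _ := by
        gcongr
        exact le_max_right _ _

theorem _root_.tail_le_pow_mul {C : ℝ} (hC : 1 ≤ C)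
    (h : ∀ r ∈ Ico (0 : ℝ) 1, tail ω r ≤ C * tail ω ((1 + r) / 2)) (k : ℕ) {r : ℝ}
    (hr : r ∈ Ico (0 : ℝ) 1) : tail ω r ≤ C ^ k * tail ω (1 - (1 - r) / 2 ^ k) := by
  induction k with
  | zero => simp
  | succ k ih =>
    have h2 : (1 : ℝ) ≤ 2 ^ k := one_le_pow₀ (by norm_num)
    have hpos : 0 < (1 - r) / 2 ^ k := div_pos (by linarith [hr.2]) (by positivity)
    have hle : (1 - r) / 2 ^ k ≤ 1 :=
      (div_le_one (by positivity)).2 (by linarith [hr.1])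
    have := h (1 - (1 - r) / 2 ^ k) ⟨by linarith, by linarith⟩
    have e : (1 + (1 - (1 - r) / 2 ^ k)) / 2 = 1 - (1 - r) / 2 ^ (k + 1) := by
      rw [pow_succ]; field_simp; ring
    rw [e] at this
    calc _ ≤ C ^ k * (C * tail ω (1 - (1 - r) / 2 ^ (k + 1))) :=
          ih.trans (mul_le_mul_of_nonneg_left this (by positivity))
      _ = _ := by ring

end IsRadialWeight

/-! ### Moments of a weight in the upper doubling class. -/

/-- The moment `∫_0^1 r^n ω(r) dr` of a radial weight. -/
noncomputable def radialMoment (ω : ℝ → ℝ) (n : ℕ) : ℝ := ∫ r in (0 : ℝ)..1, r ^ n * ω r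

namespace IsRadialWeight

variable {ω : ℝ → ℝ}

theorem intervalIntegrable_pow_mul (hω : IsRadialWeight ω) (n : ℕ) {a b : ℝ}
    (ha : a ∈ Icc (0 : ℝ) 1) (hb : b ∈ Icc (0 : ℝ) 1) :
    IntervalIntegrable (fun r => r ^ n * ω r) volume a b :=
  (hω.intervalIntegrable ha hb).continuousOn_mul (by fun_prop)

theorem pow_mul_tail_le_integral (hω : IsRadialWeight ω) (n : ℕ) {t : ℝ} (ht : t ∈ Icc (0 : ℝ) 1) :
    t ^ n * tail ω t ≤ ∫ r in t..1, r ^ n * ω r := by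
  have h1 : (1 : ℝ) ∈ Icc (0 : ℝ) 1 := by simp
  rw [tail, ← intervalIntegral.integral_const_mul]
  refine intervalIntegral.integral_mono_on_of_le_Ioo ht.2
    ((hω.intervalIntegrable ht h1).const_mul _) (hω.intervalIntegrable_pow_mul n ht h1)
    fun x hx => ?_
  have := hω.nonneg x ⟨ht.1.trans hx.1.le, hx.2⟩
  have := ht.1
  have := hx.1.le
  gcongr

theorem integral_pow_mul_nonneg (hω : IsRadialWeight ω) (n : ℕ) {a b : ℝ} (ha : 0 ≤ a)
    (hab : a ≤ b) (hb : b ≤ 1) : 0 ≤ ∫ r in a..b, r ^ n * ω r := by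
  rw [intervalIntegral.integral_of_le hab, integral_Ioc_eq_integral_Ioo]
  exact setIntegral_nonneg measurableSet_Ioo fun x hx =>
    mul_nonneg (pow_nonneg (ha.trans hx.1.le) _)
      (hω.nonneg x ⟨ha.trans hx.1.le, hx.2.trans_le hb⟩)

theorem pow_mul_tail_le_radialMoment (hω : IsRadialWeight ω) (n : ℕ) {t : ℝ}
    (ht : t ∈ Icc (0 : ℝ) 1) : t ^ n * tail ω t ≤ radialMoment ω n := by
  have h0 : (0 : ℝ) ∈ Icc (0 : ℝ) 1 := by simp
  have h1 : (1 : ℝ) ∈ Icc (0 : ℝ) 1 := by simp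
  have := intervalIntegral.integral_add_adjacent_intervals
    (hω.intervalIntegrable_pow_mul n h0 ht) (hω.intervalIntegrable_pow_mul n ht h1)
  have h2 := hω.pow_mul_tail_le_integral n ht
  have h3 := hω.integral_pow_mul_nonneg n le_rfl ht.1 ht.2
  rw [radialMoment]
  linarith

theorem radialMoment_pos (hω : IsRadialWeight ω) (n : ℕ) : 0 < radialMoment ω n :=
  lt_of_lt_of_le (mul_pos (by positivity) (hω.tail_pos (1 / 2) ⟨by norm_num, by norm_num⟩))
    (hω.pow_mul_tail_le_radialMoment n (t := 1 / 2) ⟨by norm_num, by norm_num⟩)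

theorem radialMoment_mono_fun (hω : IsRadialWeight ω) {m n : ℕ} {a b : ℝ}
    (h : ∀ x ∈ Ioo (0 : ℝ) 1, a * x ^ m ≤ b * x ^ n) :
    a * radialMoment ω m ≤ b * radialMoment ω n := by
  have h0 : (0 : ℝ) ∈ Icc (0 : ℝ) 1 := by simp
  have h1 : (1 : ℝ) ∈ Icc (0 : ℝ) 1 := by simp
  rw [radialMoment, radialMoment, ← intervalIntegral.integral_const_mul,
    ← intervalIntegral.integral_const_mul]
  refine intervalIntegral.integral_mono_on_of_le_Ioo zero_le_one
    ((hω.intervalIntegrable_pow_mul m h0 h1).const_mul _)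
    ((hω.intervalIntegrable_pow_mul n h0 h1).const_mul _) fun x hx => ?_
  have := mul_le_mul_of_nonneg_right (h x hx) (hω.nonneg x ⟨hx.1.le, hx.2⟩)
  linarith

theorem radialMoment_anti (hω : IsRadialWeight ω) {m n : ℕ} (h : m ≤ n) :
    radialMoment ω n ≤ radialMoment ω m := by
  simpa using hω.radialMoment_mono_fun (m := n) (n := m) (a := 1) (b := 1) fun x hx => by
    simpa using pow_le_pow_of_le_one hx.1.le hx.2.le h

theorem summable_exp_neg_two_pow_mul_pow (C : ℝ) (hC : 0 < C) :
    Summable fun j : ℕ => Real.exp (-2 ^ j) * C ^ (j + 1) := by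
  refine summable_of_ratio_test_tendsto_lt_one (l := 0) one_pos
    (.of_forall fun j => by positivity) ?_
  have h : ∀ j : ℕ, ‖Real.exp (-2 ^ (j + 1)) * C ^ (j + 1 + 1)‖ /
      ‖Real.exp (-2 ^ j) * C ^ (j + 1)‖ = Real.exp (-2 ^ j) * C := fun j => by
    rw [Real.norm_of_nonneg (by positivity), Real.norm_of_nonneg (by positivity),
      div_eq_iff (by positivity)]
    have : Real.exp (-2 ^ (j + 1)) = Real.exp (-2 ^ j) * Real.exp (-2 ^ j) := by
      rw [← Real.exp_add]; congr 1; ring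
    rw [this]; ring
  simp_rw [h]
  have : Tendsto (fun j : ℕ => Real.exp (-2 ^ j)) atTop (𝓝 0) :=
    Real.tendsto_exp_neg_atTop_nhds_zero.comp
      (tendsto_pow_atTop_atTop_of_one_lt (one_lt_two : (1 : ℝ) < 2))
  simpa using this.mul_const C

/-- Dyadic decomposition at the points `1 - 2^k/n`: on the `k`-th piece `r^n ≤ exp(-2^k)`, while
iterated doubling costs only `C^(k+1)`, so the sum converges as `k` grows. Truncation at `0` ends
the decomposition once `2^k ≥ n`. -/
theorem integral_pow_mul_le_sum (hω : IsRadialWeight ω) {C : ℝ} (hC : 1 ≤ C)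
    (h : ∀ r ∈ Ico (0 : ℝ) 1, tail ω r ≤ C * tail ω ((1 + r) / 2)) {n : ℕ} (hn : 1 ≤ n) (k : ℕ) :
    ∫ r in (max 0 (1 - 2 ^ k / (n : ℝ)))..1, r ^ n * ω r ≤
      tail ω (1 - 1 / n) * (1 + ∑ j ∈ Finset.range k, Real.exp (-2 ^ j) * C ^ (j + 1)) := by
  have hn0 : (0 : ℝ) < n := by exact_mod_cast hn
  have hn1 : (1 : ℝ) ≤ n := by exact_mod_cast hn
  have h1 : (1 : ℝ) ∈ Icc (0 : ℝ) 1 := by simp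
  have hinv : 1 / (n : ℝ) ≤ 1 := (div_le_one hn0).2 hn1
  have hinv0 : 0 < 1 / (n : ℝ) := by positivity
  have hmem : ∀ k : ℕ, max 0 (1 - 2 ^ k / (n : ℝ)) ∈ Ico (0 : ℝ) 1 := fun k =>
    ⟨le_max_left _ _, max_lt one_pos (by have : 0 < 2 ^ k / (n : ℝ) := by positivity
                                         linarith)⟩
  induction k with
  | zero =>
    have hm : max 0 (1 - 2 ^ 0 / (n : ℝ)) = (1 : ℝ) - 1 / (n : ℝ) := by
      rw [pow_zero, max_eq_right]; linarith
    rw [hm]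
    simp only [Finset.range_zero, Finset.sum_empty, add_zero, mul_one]
    have hI : 1 - 1 / (n : ℝ) ∈ Icc (0 : ℝ) 1 := ⟨by linarith, by linarith⟩
    refine intervalIntegral.integral_mono_on_of_le_Ioo hI.2
      (hω.intervalIntegrable_pow_mul n hI h1) (hω.intervalIntegrable hI h1) fun x hx => ?_
    have := hω.nonneg x ⟨hI.1.trans hx.1.le, hx.2⟩
    exact mul_le_of_le_one_left this (pow_le_one₀ (hI.1.trans hx.1.le) hx.2.le)
  | succ k ih =>
    set a := max 0 (1 - 2 ^ (k + 1) / (n : ℝ)) with ha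
    set b := max 0 (1 - 2 ^ k / (n : ℝ)) with hb
    have hab : a ≤ b := by
      refine max_le_max le_rfl ?_
      gcongr <;> simp
    have haI : a ∈ Icc (0 : ℝ) 1 := Ico_subset_Icc_self (hmem _)
    have hbI : b ∈ Icc (0 : ℝ) 1 := Ico_subset_Icc_self (hmem _)
    have hsplit := intervalIntegral.integral_add_adjacent_intervals
      (hω.intervalIntegrable_pow_mul n haI hbI) (hω.intervalIntegrable_pow_mul n hbI h1)
    have hfirst : ∫ r in a..b, r ^ n * ω r ≤ b ^ n * tail ω a := by
      calc ∫ r in a..b, r ^ n * ω r ≤ ∫ r in a..b, b ^ n * ω r := by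
            refine intervalIntegral.integral_mono_on_of_le_Ioo hab
              (hω.intervalIntegrable_pow_mul n haI hbI)
              ((hω.intervalIntegrable haI hbI).const_mul _) fun x hx => ?_
            have := hω.nonneg x ⟨haI.1.trans hx.1.le, hx.2.trans_le hbI.2⟩
            have := haI.1.trans hx.1.le
            have := hx.2.le
            gcongr
        _ = b ^ n * (tail ω a - tail ω b) := by
            rw [intervalIntegral.integral_const_mul, hω.tail_sub haI hbI]
        _ ≤ _ := by
            have := pow_nonneg hbI.1 n
            have := (hω.tail_pos b (hmem _)).le
            gcongr
            linarith
    have hbn : b ^ n ≤ Real.exp (-2 ^ k) := by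
      have : b ≤ Real.exp (-(2 ^ k / n)) :=
        max_le (Real.exp_pos _).le (Real.one_sub_le_exp_neg _)
      calc b ^ n ≤ Real.exp (-(2 ^ k / n)) ^ n := pow_le_pow_left₀ hbI.1 this n
        _ = _ := by rw [← Real.exp_nat_mul]; congr 1; field_simp
    have htail : tail ω a ≤ C ^ (k + 1) * tail ω (1 - 1 / n) := by
      refine (tail_le_pow_mul hC h (k + 1) (hmem _)).trans ?_
      have h2 : (1 - a) / 2 ^ (k + 1) ≤ 1 / n := by
        have : 1 - 2 ^ (k + 1) / (n : ℝ) ≤ a := le_max_right _ _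
        rw [div_le_iff₀ (by positivity)]
        calc 1 - a ≤ 2 ^ (k + 1) / (n : ℝ) := by linarith
          _ = _ := by ring
      have h3 : 0 ≤ (1 - a) / 2 ^ (k + 1) := div_nonneg (by linarith [haI.2]) (by positivity)
      refine mul_le_mul_of_nonneg_left ?_ (by positivity)
      exact hω.tail_anti (by linarith) (by linarith) (by linarith)
    have := mul_le_mul hbn htail (hω.tail_pos a (hmem _)).le (Real.exp_pos _).le
    rw [Finset.sum_range_succ]
    linarith

theorem exists_radialMoment_le (hω : IsRadialWeight ω) (hup : UpperDoubling ω) :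
    ∃ D : ℝ, 0 < D ∧ ∀ n : ℕ, 1 ≤ n → radialMoment ω n ≤ D * tail ω (1 - 1 / n) := by
  obtain ⟨C, hC, h⟩ := hω.exists_doubling hup
  have hs := summable_exp_neg_two_pow_mul_pow C (by linarith)
  refine ⟨1 + ∑' j : ℕ, Real.exp (-2 ^ j) * C ^ (j + 1), ?_, fun n hn => ?_⟩
  · have : 0 ≤ ∑' j : ℕ, Real.exp (-2 ^ j) * C ^ (j + 1) := tsum_nonneg fun j => by positivity
    linarith
  have hn0 : (0 : ℝ) < n := by exact_mod_cast hn
  have hn1 : (1 : ℝ) ≤ n := by exact_mod_cast hn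
  have := hω.integral_pow_mul_le_sum hC h hn n
  have hmax : max 0 (1 - 2 ^ n / (n : ℝ)) = 0 := by
    refine max_eq_left ?_
    have h2 : (n : ℝ) ≤ 2 ^ n := by exact_mod_cast Nat.lt_two_pow_self.le
    have := (one_le_div hn0).2 h2
    linarith
  rw [hmax] at this
  rw [radialMoment, mul_comm]
  have hi : 1 / (n : ℝ) ≤ 1 := (div_le_one hn0).2 hn1
  have hi0 : 0 < 1 / (n : ℝ) := by positivity
  have hp := (hω.tail_pos (1 - 1 / (n : ℝ)) ⟨by linarith, by linarith⟩).le
  refine this.trans (mul_le_mul_of_nonneg_left ?_ hp)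
  gcongr
  exact hs.sum_le_tsum _ fun j _ => by positivity

theorem exists_radialMoment_le_two_mul_add_one (hω : IsRadialWeight ω) (hup : UpperDoubling ω) :
    ∃ D : ℝ, 0 < D ∧ ∀ n : ℕ, 1 ≤ n → radialMoment ω n ≤ D * radialMoment ω (2 * n + 1) := by
  obtain ⟨C, hC, h⟩ := hω.exists_doubling hup
  obtain ⟨D, hD, hDn⟩ := hω.exists_radialMoment_le hup
  refine ⟨8 * D * C, by positivity, fun n hn => ?_⟩
  have hn0 : (0 : ℝ) < n := by exact_mod_cast hn
  have hn1 : (1 : ℝ) ≤ n := by exact_mod_cast hn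
  have hi : 1 / (n : ℝ) ≤ 1 := (div_le_one hn0).2 hn1
  have hi0 : 0 < 1 / (n : ℝ) := by positivity
  -- One doubling step from `1 - 1/n`; Bernoulli keeps `t^n ≥ 1/2`, whence the constant `8`.
  set t : ℝ := 1 - 1 / n / 2 with ht
  have htI : t ∈ Icc (0 : ℝ) 1 := ⟨by linarith, by linarith⟩
  have h1 := h (1 - 1 / n) ⟨by linarith, by linarith⟩
  have e : (1 + (1 - 1 / (n : ℝ))) / 2 = t := by rw [ht]; ring
  rw [e] at h1
  have h2 := hω.pow_mul_tail_le_radialMoment (2 * n + 1) htI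
  have h3 : 1 / 8 ≤ t ^ (2 * n + 1) := by
    have hb : 1 / 2 ≤ t ^ n := by
      have := one_add_mul_le_pow (a := -(1 / (n : ℝ) / 2)) (by linarith) n
      calc (1 : ℝ) / 2 = 1 + n * -(1 / (n : ℝ) / 2) := by field_simp; norm_num
        _ ≤ _ := this
    have hb2 : 1 / 2 ≤ t := by linarith
    calc (1 : ℝ) / 8 = (1 / 2) ^ 2 * (1 / 2) := by norm_num
      _ ≤ (t ^ n) ^ 2 * t := by gcongr
      _ = _ := by ring
  have hpos := (hω.tail_pos t ⟨htI.1, by linarith⟩).le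
  calc radialMoment ω n ≤ D * tail ω (1 - 1 / n) := hDn n hn
    _ ≤ D * (C * tail ω t) := by gcongr
    _ = 8 * D * C * (1 / 8 * tail ω t) := by ring
    _ ≤ 8 * D * C * radialMoment ω (2 * n + 1) := by
      gcongr
      exact (mul_le_mul_of_nonneg_right h3 hpos).trans h2

/-- Each of the `n` terms of `1 + x + ... + x^(n-1) = (1 - x^n)/(1 - x)` is at least `x^n`. -/
theorem _root_.natCast_mul_pow_mul_one_sub_le {x : ℝ} (hx : x ∈ Ioo (0 : ℝ) 1) (n : ℕ) :
    n * x ^ n * (1 - x) ≤ 1 := by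
  have h := geom_sum_mul_neg x n
  have h2 : (n : ℝ) * x ^ n ≤ ∑ i ∈ Finset.range n, x ^ i := by
    have := Finset.card_nsmul_le_sum (Finset.range n) (fun i => x ^ i) (x ^ n) fun i hi =>
      pow_le_pow_of_le_one hx.1.le hx.2.le (Finset.mem_range.1 hi).le
    simpa using this
  have := mul_le_mul_of_nonneg_right h2 (by linarith [hx.2] : 0 ≤ 1 - x)
  have := pow_pos hx.1 n
  linarith

/-- Half of the power in `x^(2n+1)` is spent on absorbing `n (1-x)`. What remains is the moment of
order `n`, which doubling compares with the one of order `2n+1`. This controls the coefficients of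
`(1-w) Φ'(w)`. -/
theorem exists_natCast_mul_radialMoment_sub_le (hω : IsRadialWeight ω) (hup : UpperDoubling ω) :
    ∃ D : ℝ, 0 < D ∧ ∀ n : ℕ,
      n * (radialMoment ω (2 * n + 1) - radialMoment ω (2 * n + 3)) ≤
        D * radialMoment ω (2 * n + 1) := by
  obtain ⟨D, hD, h⟩ := hω.exists_radialMoment_le_two_mul_add_one hup
  refine ⟨2 * D, by positivity, fun n => ?_⟩
  rcases Nat.eq_zero_or_pos n with rfl | hn
  · have := hω.radialMoment_pos 1
    simp; positivity
  have h0 : (0 : ℝ) ∈ Icc (0 : ℝ) 1 := by simp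
  have h1 : (1 : ℝ) ∈ Icc (0 : ℝ) 1 := by simp
  have hi := fun m => hω.intervalIntegrable_pow_mul m h0 h1
  have key : (n : ℝ) * (radialMoment ω (2 * n + 1) - radialMoment ω (2 * n + 3)) ≤
      2 * radialMoment ω n := by
    rw [radialMoment, radialMoment, radialMoment, ← intervalIntegral.integral_sub (hi _) (hi _),
      ← intervalIntegral.integral_const_mul, ← intervalIntegral.integral_const_mul]
    refine intervalIntegral.integral_mono_on_of_le_Ioo zero_le_one
      (((hi _).sub (hi _)).const_mul _) ((hi _).const_mul _) fun x hx => ?_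
    have hwx := hω.nonneg x ⟨hx.1.le, hx.2⟩
    have hb := natCast_mul_pow_mul_one_sub_le hx n
    have hxn : 0 ≤ x ^ n := pow_nonneg hx.1.le n
    have hfac : x * (1 + x) ≤ 2 := by nlinarith [hx.1, hx.2]
    have hfac0 : 0 ≤ x * (1 + x) := by nlinarith [hx.1]
    have h3 : n * x ^ n * (1 - x) * (x * (1 + x)) ≤ 1 * 2 :=
      mul_le_mul hb hfac hfac0 zero_le_one
    calc (n : ℝ) * (x ^ (2 * n + 1) * ω x - x ^ (2 * n + 3) * ω x)
        = n * x ^ n * (1 - x) * (x * (1 + x)) * (x ^ n * ω x) := by ring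
      _ ≤ 1 * 2 * (x ^ n * ω x) := by gcongr
      _ = _ := by ring
  calc _ ≤ 2 * radialMoment ω n := key
    _ ≤ 2 * (D * radialMoment ω (2 * n + 1)) := by gcongr; exact h n hn
    _ = _ := by ring

end IsRadialWeight

/-! ### Polar coordinates on the disc. -/

theorem integrableOn_polarCoord_symm {E : Type*} [NormedAddCommGroup E] [NormedSpace ℝ E]
    {F : ℂ → E} (hF : Integrable F) :
    IntegrableOn (fun p : ℝ × ℝ => p.1 • F (Complex.polarCoord.symm p)) polarCoord.target := by
  have h1 : Integrable (F ∘ Complex.measurableEquivRealProd.symm) (volume : Measure (ℝ × ℝ)) :=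
    (Complex.volume_preserving_equiv_real_prod.symm).integrable_comp_emb
      Complex.measurableEquivRealProd.symm.measurableEmbedding |>.2 hF
  have h2 := (integrableOn_image_iff_integrableOn_abs_det_fderiv_smul volume
    (measurableSet_Ioi.prod measurableSet_Ioo : MeasurableSet polarCoord.target)
    (fun p _ => (hasFDerivAt_polarCoord_symm p).hasFDerivWithinAt)
    polarCoord.symm.injOn (F ∘ Complex.measurableEquivRealProd.symm)).1 h1.integrableOn
  refine h2.congr_fun (fun p hp => ?_) (measurableSet_Ioi.prod measurableSet_Ioo)
  have hp1 : 0 < p.1 := hp.1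
  simp only [det_fderivPolarCoordSymm, abs_of_pos hp1, Function.comp_apply]
  rfl

theorem measurableSet_disc : MeasurableSet disc := measurableSet_ball

theorem mem_disc {z : ℂ} : z ∈ disc ↔ ‖z‖ < 1 := by simp [disc]

theorem isOpen_disc : IsOpen disc := Metric.isOpen_ball

theorem integrable_dA_iff {E : Type*} [NormedAddCommGroup E] {F : ℂ → E} :
    Integrable F dA ↔ IntegrableOn F disc := by
  rw [dA, integrable_smul_measure (by simp [Real.pi_pos]) ENNReal.ofReal_ne_top]
  rfl

theorem ae_dA_iff {p : ℂ → Prop} : (∀ᵐ z ∂dA, p z) ↔ ∀ᵐ z ∂volume.restrict disc, p z := by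
  have h : ENNReal.ofReal (Real.pi⁻¹) ≠ 0 := by simp [Real.pi_pos]
  rw [dA, ae_iff, ae_iff, Measure.smul_apply, smul_eq_mul, mul_eq_zero]
  simp [h]

theorem ae_dA_mem_disc : ∀ᵐ z ∂dA, z ∈ disc :=
  ae_dA_iff.2 (ae_restrict_mem measurableSet_disc)

/-- Integration in polar coordinates over the disc, together with the integrability of the
integrand in polar coordinates. -/
theorem integral_dA_polar {E : Type*} [NormedAddCommGroup E] [NormedSpace ℝ E]
    {F : ℂ → E} (hF : Integrable F dA) :
    IntegrableOn (fun r : ℝ => ∫ θ in Ioo (-Real.pi) Real.pi, r • F (r * Complex.exp (θ * Complex.I)))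
      (Ioo 0 1) ∧
    ∫ ζ, F ζ ∂dA = Real.pi⁻¹ • ∫ r in Ioo (0 : ℝ) 1, ∫ θ in Ioo (-Real.pi) Real.pi,
      r • F (r * Complex.exp (θ * Complex.I)) := by
  have hF' : Integrable (disc.indicator F) :=
    (integrable_indicator_iff measurableSet_disc).2 (integrable_dA_iff.1 hF)
  have h2 := integrableOn_polarCoord_symm hF'
  have hexp : ∀ p : ℝ × ℝ, Complex.polarCoord.symm p = p.1 * Complex.exp (p.2 * Complex.I) := by
    intro p
    rw [Complex.polarCoord_symm_apply, Complex.exp_mul_I]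
    push_cast
    rfl
  have hsub : Ioo (0 : ℝ) 1 ×ˢ Ioo (-Real.pi) Real.pi ⊆ polarCoord.target :=
    prod_mono Ioo_subset_Ioi_self le_rfl
  have hmeas : MeasurableSet (Ioo (0 : ℝ) 1 ×ˢ Ioo (-Real.pi) Real.pi) :=
    measurableSet_Ioo.prod measurableSet_Ioo
  have heq : EqOn (fun p : ℝ × ℝ => p.1 • disc.indicator F (Complex.polarCoord.symm p))
      (fun p : ℝ × ℝ => p.1 • F (p.1 * Complex.exp (p.2 * Complex.I)))
      (Ioo (0 : ℝ) 1 ×ˢ Ioo (-Real.pi) Real.pi) := by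
    intro p hp
    have : (p.1 : ℂ) * Complex.exp (p.2 * Complex.I) ∈ disc := by
      rw [mem_disc, norm_mul, Complex.norm_exp_ofReal_mul_I, Complex.norm_real,
        Real.norm_of_nonneg hp.1.1.le, mul_one]
      exact hp.1.2
    simp only [hexp, indicator_of_mem this]
  have hint : IntegrableOn (fun p : ℝ × ℝ => p.1 • F (p.1 * Complex.exp (p.2 * Complex.I)))
      (Ioo (0 : ℝ) 1 ×ˢ Ioo (-Real.pi) Real.pi) :=
    (h2.mono_set hsub).congr_fun heq hmeas
  rw [Measure.volume_eq_prod] at hint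
  constructor
  · have := hint
    rw [IntegrableOn, ← Measure.prod_restrict] at this
    exact this.integral_prod_left
  · rw [dA, integral_smul_measure, ENNReal.toReal_ofReal (by positivity),
      ← integral_indicator measurableSet_disc, ← Complex.integral_comp_polarCoord_symm]
    congr 1
    rw [← setIntegral_prod (fun p : ℝ × ℝ => p.1 • F (p.1 * Complex.exp (p.2 * Complex.I))) hint,
      ← Measure.volume_eq_prod]
    rw [← setIntegral_congr_fun hmeas heq]
    refine setIntegral_eq_of_subset_of_forall_sdiff_eq_zero
      (measurableSet_Ioi.prod measurableSet_Ioo) hsub fun p hp => ?_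
    have hp0 : 0 < p.1 := hp.1.1
    have : Complex.polarCoord.symm p ∉ disc := by
      rw [mem_disc, Complex.norm_polarCoord_symm, abs_of_pos hp0]
      intro h
      exact hp.2 ⟨⟨hp0, h⟩, hp.1.2⟩
    rw [indicator_of_notMem this, smul_zero]

/-- A function integrable on `(0, 1)` extends to a radial integrable function on the disc. -/
theorem integrable_dA_comp_norm {E : Type*} [NormedAddCommGroup E] [NormedSpace ℝ E] {φ : ℝ → E}
    (h : IntegrableOn φ (Ioo 0 1)) : Integrable (fun ζ : ℂ => φ ‖ζ‖) dA := by
  have h1 : IntegrableOn (fun y : ℝ => y ^ (Module.finrank ℝ ℂ - 1) • (Ioo (0 : ℝ) 1).indicator φ y)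
      (Ioi 0) := by
    have : (fun y : ℝ => y ^ (Module.finrank ℝ ℂ - 1) • (Ioo (0 : ℝ) 1).indicator φ y) =
        (Ioo (0 : ℝ) 1).indicator fun y => y • φ y := by
      ext y
      by_cases hy : y ∈ Ioo (0 : ℝ) 1 <;> simp [hy, Complex.finrank_real_complex]
    rw [this]
    refine Integrable.integrableOn ((integrable_indicator_iff measurableSet_Ioo).2 ?_)
    refine Integrable.bdd_smul h 1 (by fun_prop)
      ((ae_restrict_iff' measurableSet_Ioo).2 (.of_forall fun x hx => ?_))
    rw [Real.norm_of_nonneg hx.1.le]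
    exact hx.2.le
  have h2 := (integrable_fun_norm_addHaar (volume : Measure ℂ)).2 h1
  rw [integrable_dA_iff]
  refine (h2.integrableOn (s := disc)).congr ?_
  have h0 : ∀ᵐ z : ℂ, z ≠ 0 := by simp [ae_iff]
  filter_upwards [ae_restrict_mem measurableSet_disc, ae_restrict_of_ae h0] with z hz hz0
  exact indicator_of_mem (show ‖z‖ ∈ Ioo (0 : ℝ) 1 from ⟨norm_pos_iff.2 hz0, mem_disc.1 hz⟩) _

/-! ### Absolutely convergent Fourier series and Parseval. -/

theorem integral_exp_int_mul_I (k : ℤ) :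
    ∫ θ in Ioo (-Real.pi) Real.pi, Complex.exp (k * θ * Complex.I) =
      if k = 0 then (2 * Real.pi : ℂ) else 0 := by
  rw [← integral_Ioc_eq_integral_Ioo, ← intervalIntegral.integral_of_le (by linarith [Real.pi_pos])]
  split_ifs with hk
  · subst hk
    simp
    ring
  · have hc : (k * Complex.I : ℂ) ≠ 0 := by simp [hk]
    have := integral_exp_mul_complex (a := -Real.pi) (b := Real.pi) hc
    have e : ∀ θ : ℝ, Complex.exp (k * θ * Complex.I) = Complex.exp (k * Complex.I * θ) :=
      fun θ => by congr 1; ring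
    simp_rw [e]
    rw [this, div_eq_zero_iff]
    left
    rw [sub_eq_zero, Complex.exp_eq_exp_iff_exists_int]
    exact ⟨k, by push_cast; ring⟩

theorem integrableOn_Ioo_of_continuous {E : Type*} [NormedAddCommGroup E] {f : ℝ → E}
    (hf : Continuous f) (a b : ℝ) : IntegrableOn f (Ioo a b) :=
  (hf.integrableOn_Icc).mono_set Ioo_subset_Icc_self

theorem norm_mul_exp_int (a : ℂ) (k : ℤ) (θ : ℝ) :
    ‖a * Complex.exp (k * θ * Complex.I)‖ = ‖a‖ := by
  have : (k * θ * Complex.I : ℂ) = ((k * θ : ℝ) : ℂ) * Complex.I := by push_cast; ring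
  rw [norm_mul, this, Complex.norm_exp_ofReal_mul_I, mul_one]

/-- Integration of an absolutely convergent trigonometric series against a bounded continuous
function, term by term. -/
theorem hasSum_integral_mul_exp {a : ℕ → ℂ} (ha : Summable fun n => ‖a n‖) (σ : ℤ) {h : ℝ → ℂ}
    (hh : Continuous h) :
    HasSum (fun n : ℕ => a n * ∫ θ in Ioo (-Real.pi) Real.pi,
        h θ * Complex.exp ((σ * n : ℤ) * θ * Complex.I))
      (∫ θ in Ioo (-Real.pi) Real.pi,
        h θ * ∑' n : ℕ, a n * Complex.exp ((σ * n : ℤ) * θ * Complex.I)) := by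
  have hI : ∀ n : ℕ, IntegrableOn (fun θ : ℝ => h θ *
      (a n * Complex.exp ((σ * n : ℤ) * θ * Complex.I))) (Ioo (-Real.pi) Real.pi) := fun n =>
    integrableOn_Ioo_of_continuous (by fun_prop) _ _
  have key := hasSum_integral_of_summable_integral_norm hI (by
    have : ∀ n : ℕ, ∫ θ in Ioo (-Real.pi) Real.pi, ‖h θ * (a n * Complex.exp ((σ * n : ℤ) * θ *
        Complex.I))‖ = ‖a n‖ * ∫ θ in Ioo (-Real.pi) Real.pi, ‖h θ‖ := fun n => by
      rw [← integral_const_mul]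
      congr 1 with θ
      rw [norm_mul, norm_mul_exp_int, mul_comm]
    simp_rw [this]
    exact ha.mul_right _)
  convert! key using 1
  · ext n
    rw [← integral_const_mul]
    congr 1 with θ
    ring
  · congr 1 with θ
    rw [tsum_mul_left]

theorem integral_tsum_mul_exp_neg {a : ℕ → ℂ} (ha : Summable fun n => ‖a n‖) (m : ℕ) :
    ∫ θ in Ioo (-Real.pi) Real.pi, Complex.exp ((-m : ℤ) * θ * Complex.I) *
      ∑' n : ℕ, a n * Complex.exp ((1 * n : ℤ) * θ * Complex.I) = 2 * Real.pi * a m := by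
  have h := hasSum_integral_mul_exp ha 1
    (h := fun θ => Complex.exp ((-m : ℤ) * θ * Complex.I)) (by fun_prop)
  refine h.unique ?_
  have e : ∀ n : ℕ, ∫ θ in Ioo (-Real.pi) Real.pi, Complex.exp ((-m : ℤ) * θ * Complex.I) *
      Complex.exp ((1 * n : ℤ) * θ * Complex.I) = if n = m then (2 * Real.pi : ℂ) else 0 := fun n => by
    have := integral_exp_int_mul_I (n - m)
    simp only [show ((n : ℤ) - m = 0) ↔ n = m by omega] at this
    rw [← this]
    congr 1 with θ
    rw [← Complex.exp_add]
    congr 1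
    push_cast
    ring
  simp_rw [e]
  convert hasSum_single m fun n hn => ?_ using 1
  · simp; ring
  · simp [hn]

theorem continuous_tsum_mul_exp {a : ℕ → ℂ} (ha : Summable fun n => ‖a n‖) (σ : ℤ) :
    Continuous fun θ : ℝ => ∑' n : ℕ, a n * Complex.exp ((σ * n : ℤ) * θ * Complex.I) :=
  continuous_tsum (fun n => by fun_prop) ha fun n θ => (norm_mul_exp_int _ _ _).le

/-- Parseval's identity for an absolutely convergent trigonometric series. -/
theorem hasSum_norm_sq_trig {a : ℕ → ℂ} (ha : Summable fun n => ‖a n‖) :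
    HasSum (fun n => 2 * Real.pi * ‖a n‖ ^ 2)
      (∫ θ in Ioo (-Real.pi) Real.pi,
        ‖∑' n : ℕ, a n * Complex.exp (-(n * θ * Complex.I))‖ ^ 2) := by
  have hc : Summable fun n => ‖conj (a n)‖ := by simpa using ha
  have hconj : ∀ θ : ℝ, conj (∑' n : ℕ, a n * Complex.exp (-(n * θ * Complex.I))) =
      ∑' n : ℕ, conj (a n) * Complex.exp ((1 * n : ℤ) * θ * Complex.I) := fun θ => by
    rw [Complex.conj_tsum]
    congr 1 with n
    rw [map_mul, ← Complex.exp_conj]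
    congr 2
    simp
  -- Only one factor of `|S|^2 = conj S * S` is expanded; the other serves as the continuous test
  -- function, and its Fourier coefficients are already known.
  have h := hasSum_integral_mul_exp ha (-1) (continuous_tsum_mul_exp hc 1)
  have h2 : ∀ n : ℕ, a n * ∫ θ in Ioo (-Real.pi) Real.pi,
      (∑' k : ℕ, conj (a k) * Complex.exp ((1 * k : ℤ) * θ * Complex.I)) *
        Complex.exp ((-1 * n : ℤ) * θ * Complex.I) = ((2 * Real.pi * ‖a n‖ ^ 2 : ℝ) : ℂ) := fun n => by
    have := integral_tsum_mul_exp_neg hc n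
    simp_rw [mul_comm (tsum _), neg_one_mul]
    rw [this, mul_left_comm, Complex.mul_conj']
    push_cast
    ring
  simp_rw [h2] at h
  have h3 : ∫ θ in Ioo (-Real.pi) Real.pi,
      (∑' k : ℕ, conj (a k) * Complex.exp ((1 * k : ℤ) * θ * Complex.I)) *
        ∑' n : ℕ, a n * Complex.exp ((-1 * n : ℤ) * θ * Complex.I) =
      ((∫ θ in Ioo (-Real.pi) Real.pi,
        ‖∑' n : ℕ, a n * Complex.exp (-(n * θ * Complex.I))‖ ^ 2 : ℝ) : ℂ) := by
    rw [← integral_complex_ofReal]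
    congr 1 with θ
    rw [← hconj]
    have : (∑' n : ℕ, a n * Complex.exp ((-1 * n : ℤ) * θ * Complex.I)) =
        ∑' n : ℕ, a n * Complex.exp (-(n * θ * Complex.I)) := by
      congr 1 with n
      congr 2
      push_cast
      ring
    rw [this, Complex.conj_mul']
    push_cast
    rfl
  rw [h3] at h
  exact_mod_cast h

/-! ### The Bergman kernel as a power series. -/

/-- The Taylor coefficients of the Bergman kernel of a radial weight. -/
noncomputable def kernelCoeff (ω : ℝ → ℝ) (n : ℕ) : ℝ := (2 * radialMoment ω (2 * n + 1))⁻¹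

/-- The function `Φ` with `B_z^ω(ζ) = Φ(conj z * ζ)`. -/
noncomputable def kernelSeries (ω : ℝ → ℝ) (w : ℂ) : ℂ := ∑' n : ℕ, (kernelCoeff ω n : ℂ) * w ^ n

theorem conj_kernelSeries (ω : ℝ → ℝ) (w : ℂ) :
    conj (kernelSeries ω w) = kernelSeries ω (conj w) := by
  simp [kernelSeries, Complex.conj_tsum]

namespace IsRadialWeight

variable {ω : ℝ → ℝ}

theorem kernelCoeff_pos (hω : IsRadialWeight ω) (n : ℕ) : 0 < kernelCoeff ω n :=
  inv_pos.2 (mul_pos two_pos (hω.radialMoment_pos _))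

theorem kernelCoeff_le (hω : IsRadialWeight ω) (n : ℕ) {t : ℝ} (ht : t ∈ Ioo (0 : ℝ) 1) :
    kernelCoeff ω n ≤ (2 * (t ^ (2 * n + 1) * tail ω t))⁻¹ := by
  have h1 := hω.pow_mul_tail_le_radialMoment (2 * n + 1) (Ioo_subset_Icc_self ht)
  have h2 := hω.tail_pos t (Ioo_subset_Ico_self ht)
  have := ht.1
  unfold kernelCoeff
  gcongr

theorem summable_kernelCoeff_mul_pow (hω : IsRadialWeight ω) {x : ℝ} (hx : x ∈ Ico (0 : ℝ) 1) :
    Summable fun n => kernelCoeff ω n * x ^ n := by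
  -- The coefficients grow at most like `t^(-2n)`, and `t^2 > x` because `t^2 - x = ((1-x)/2)^2`.
  obtain ⟨t, ht⟩ : ∃ t : ℝ, t = (1 + x) / 2 := ⟨_, rfl⟩
  have htI : t ∈ Ioo (0 : ℝ) 1 := ⟨by linarith [hx.1], by linarith [hx.2]⟩
  have h2 := hω.tail_pos t (Ioo_subset_Ico_self htI)
  have ht0 := htI.1
  have hlt : x / t ^ 2 < 1 := by
    rw [div_lt_one (by positivity)]
    nlinarith [hx.1, hx.2, sq_pos_of_pos (sub_pos.2 hx.2)]
  refine Summable.of_nonneg_of_le (fun n => mul_nonneg (hω.kernelCoeff_pos n).le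
    (pow_nonneg hx.1 n)) (fun n => ?_)
    ((summable_geometric_of_lt_one (div_nonneg hx.1 (by positivity)) hlt).mul_left
      ((2 * (t * tail ω t))⁻¹))
  calc kernelCoeff ω n * x ^ n ≤ (2 * (t ^ (2 * n + 1) * tail ω t))⁻¹ * x ^ n :=
        mul_le_mul_of_nonneg_right (hω.kernelCoeff_le n htI) (pow_nonneg hx.1 n)
    _ = _ := by rw [div_pow, ← pow_mul]; field_simp; ring

theorem norm_kernelTerm (hω : IsRadialWeight ω) (n : ℕ) (w : ℂ) :
    ‖(kernelCoeff ω n : ℂ) * w ^ n‖ = kernelCoeff ω n * ‖w‖ ^ n := by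
  rw [norm_mul, norm_pow, Complex.norm_real, Real.norm_of_nonneg (hω.kernelCoeff_pos n).le]

theorem norm_mem_Ico {w : ℂ} (hw : w ∈ disc) : ‖w‖ ∈ Ico (0 : ℝ) 1 :=
  ⟨norm_nonneg _, mem_disc.1 hw⟩

theorem summable_norm_kernelTerm (hω : IsRadialWeight ω) {w : ℂ} (hw : w ∈ disc) :
    Summable fun n => ‖(kernelCoeff ω n : ℂ) * w ^ n‖ := by
  simp_rw [hω.norm_kernelTerm]
  exact hω.summable_kernelCoeff_mul_pow (norm_mem_Ico hw)

theorem hasSum_kernelSeries (hω : IsRadialWeight ω) {w : ℂ} (hw : w ∈ disc) :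
    HasSum (fun n => (kernelCoeff ω n : ℂ) * w ^ n) (kernelSeries ω w) :=
  (hω.summable_norm_kernelTerm hw).of_norm.hasSum

theorem norm_kernelTerm_le (hω : IsRadialWeight ω) {x : ℝ} {w : ℂ}
    (hw : w ∈ Metric.ball (0 : ℂ) x) (n : ℕ) :
    ‖(kernelCoeff ω n : ℂ) * w ^ n‖ ≤ kernelCoeff ω n * x ^ n := by
  rw [hω.norm_kernelTerm]
  have h1 : ‖w‖ ≤ x := by simpa using (Metric.mem_ball.1 hw).le
  have := (hω.kernelCoeff_pos n).le
  gcongr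

theorem mem_ball_midpoint {w : ℂ} (hw : w ∈ disc) :
    (1 + ‖w‖) / 2 ∈ Ico (0 : ℝ) 1 ∧ w ∈ Metric.ball (0 : ℂ) ((1 + ‖w‖) / 2) := by
  have := norm_nonneg w
  have h1 := mem_disc.1 hw
  refine ⟨⟨by linarith, by linarith⟩, ?_⟩
  rw [mem_ball_zero_iff]
  linarith

theorem differentiableOn_kernelSeries (hω : IsRadialWeight ω) :
    DifferentiableOn ℂ (kernelSeries ω) disc := by
  intro w hw
  obtain ⟨h1, h2⟩ := mem_ball_midpoint hw
  have := Complex.differentiableOn_tsum_of_summable_norm (hω.summable_kernelCoeff_mul_pow h1)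
    (fun n => by fun_prop) Metric.isOpen_ball (fun n v hv => hω.norm_kernelTerm_le hv n)
  exact (this.differentiableAt (Metric.isOpen_ball.mem_nhds h2)).differentiableWithinAt

theorem hasSum_deriv_kernelSeries (hω : IsRadialWeight ω) {w : ℂ} (hw : w ∈ disc) :
    HasSum (fun n : ℕ => ((n + 1) * kernelCoeff ω (n + 1) : ℂ) * w ^ n)
      (deriv (kernelSeries ω) w) := by
  obtain ⟨h1, h2⟩ := mem_ball_midpoint hw
  have := Complex.hasSum_deriv_of_summable_norm (hω.summable_kernelCoeff_mul_pow h1)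
    (F := fun n w => (kernelCoeff ω n : ℂ) * w ^ n)
    (fun n => by fun_prop) Metric.isOpen_ball (fun n v hv => hω.norm_kernelTerm_le hv n) h2
  have h3 := (hasSum_nat_add_iff' (f := fun n => deriv (fun w => (kernelCoeff ω n : ℂ) * w ^ n) w)
    1).2 this
  convert! h3 using 1
  · ext n
    simp
    ring
  · simp
    rfl

theorem _root_.mul_conj_mem_disc {z ζ : ℂ} (hz : z ∈ disc) (hζ : ‖ζ‖ ≤ 1) : z * conj ζ ∈ disc := by
  rw [mem_disc] at *
  rw [norm_mul, RCLike.norm_conj]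
  exact mul_lt_one_of_nonneg_of_lt_one_left (norm_nonneg _) hz hζ

theorem _root_.norm_mul_conj_le {z ζ : ℂ} (hζ : ζ ∈ disc) : ‖z * conj ζ‖ ≤ ‖z‖ := by
  rw [norm_mul, RCLike.norm_conj]
  exact mul_le_of_le_one_right (norm_nonneg _) (mem_disc.1 hζ).le

theorem _root_.aestronglyMeasurable_dA_of_continuousOn {f : ℂ → ℂ} (hf : ContinuousOn f disc) :
    AEStronglyMeasurable f dA :=
  (hf.aestronglyMeasurable measurableSet_disc).smul_measure _

theorem norm_kernelSeries_le (hω : IsRadialWeight ω) {z : ℂ} (hz : z ∈ disc) {w : ℂ}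
    (hw : ‖w‖ ≤ ‖z‖) : ‖kernelSeries ω w‖ ≤ ∑' n, kernelCoeff ω n * ‖z‖ ^ n := by
  refine tsum_of_norm_bounded (hω.summable_kernelCoeff_mul_pow (norm_mem_Ico hz)).hasSum fun n => ?_
  rw [hω.norm_kernelTerm]
  have := (hω.kernelCoeff_pos n).le
  gcongr

theorem continuousOn_kernelSeries_mul_conj (hω : IsRadialWeight ω) {z : ℂ} (hz : z ∈ disc) :
    ContinuousOn (fun ζ => kernelSeries ω (z * conj ζ)) disc :=
  hω.differentiableOn_kernelSeries.continuousOn.comp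
    (by fun_prop) fun ζ hζ => mul_conj_mem_disc hz (mem_disc.1 hζ).le

theorem integrable_mul_kernelSeries (hω : IsRadialWeight ω) {G : ℂ → ℂ} (hG : Integrable G dA)
    {z : ℂ} (hz : z ∈ disc) : Integrable (fun ζ => G ζ * kernelSeries ω (z * conj ζ)) dA := by
  refine hG.mul_bdd (c := ∑' n, kernelCoeff ω n * ‖z‖ ^ n)
    (aestronglyMeasurable_dA_of_continuousOn (hω.continuousOn_kernelSeries_mul_conj hz)) ?_
  filter_upwards [ae_dA_mem_disc] with ζ hζ
  exact hω.norm_kernelSeries_le hz (norm_mul_conj_le hζ)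

theorem integrable_mul_conj_pow {G : ℂ → ℂ} (hG : Integrable G dA) (n : ℕ) :
    Integrable (fun ζ => G ζ * conj ζ ^ n) dA := by
  refine hG.mul_bdd (c := 1) (by fun_prop) ?_
  filter_upwards [ae_dA_mem_disc] with ζ hζ
  rw [norm_pow, RCLike.norm_conj]
  exact pow_le_one₀ (norm_nonneg _) (mem_disc.1 hζ).le

/-- Integration against the Bergman kernel, term by term. -/
theorem hasSum_integral_mul_kernelSeries (hω : IsRadialWeight ω) {G : ℂ → ℂ}
    (hG : Integrable G dA) {z : ℂ} (hz : z ∈ disc) :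
    HasSum (fun n => (kernelCoeff ω n : ℂ) * z ^ n * ∫ ζ, G ζ * conj ζ ^ n ∂dA)
      (∫ ζ, G ζ * kernelSeries ω (z * conj ζ) ∂dA) := by
  have hI : ∀ n : ℕ, Integrable (fun ζ => (kernelCoeff ω n : ℂ) * z ^ n * (G ζ * conj ζ ^ n)) dA :=
    fun n => (integrable_mul_conj_pow hG n).const_mul _
  have key := hasSum_integral_of_summable_integral_norm hI (by
    refine Summable.of_nonneg_of_le (fun n => integral_nonneg fun _ => norm_nonneg _) (fun n => ?_)
      ((hω.summable_kernelCoeff_mul_pow (norm_mem_Ico hz)).mul_right (∫ ζ, ‖G ζ‖ ∂dA))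
    rw [← integral_const_mul]
    refine integral_mono_ae (hI n).norm (hG.norm.const_mul _) ?_
    filter_upwards [ae_dA_mem_disc] with ζ hζ
    rw [norm_mul, hω.norm_kernelTerm, norm_mul, norm_pow, RCLike.norm_conj]
    refine mul_le_mul_of_nonneg_left (mul_le_of_le_one_right (norm_nonneg _)
      (pow_le_one₀ (norm_nonneg _) (mem_disc.1 hζ).le)) (mul_nonneg (hω.kernelCoeff_pos n).le
        (by positivity)))
  convert! key using 1
  · ext n
    rw [integral_const_mul]
  · refine integral_congr_ae ?_
    filter_upwards [ae_dA_mem_disc] with ζ hζ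
    rw [← (hω.hasSum_kernelSeries (mul_conj_mem_disc hz (mem_disc.1 hζ).le)).tsum_eq,
      ← tsum_mul_left]
    congr 1 with n
    rw [mul_pow]
    ring

theorem integrable_weight (hω : IsRadialWeight ω) : Integrable (fun ζ : ℂ => ω ‖ζ‖) dA :=
  integrable_dA_comp_norm hω.integrableOn_Ioo

theorem integrable_weight_ofReal (hω : IsRadialWeight ω) :
    Integrable (fun ζ : ℂ => (ω ‖ζ‖ : ℂ)) dA := hω.integrable_weight.ofReal

theorem ae_weight_nonneg (hω : IsRadialWeight ω) : ∀ᵐ ζ ∂dA, 0 ≤ ω ‖ζ‖ := by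
  filter_upwards [ae_dA_mem_disc] with ζ hζ
  exact hω.nonneg _ (norm_mem_Ico hζ)

/-- Follows from `|f| ≤ 1 + |f|^2`, as `ω` is itself integrable over the disc. -/
theorem integrable_mul_weight (hω : IsRadialWeight ω) {f : ℂ → ℂ} (hf : MemBergman ω f) :
    Integrable (fun ζ => f ζ * (ω ‖ζ‖ : ℂ)) dA := by
  refine (hω.integrable_weight.add hf.2).mono'
    ((aestronglyMeasurable_dA_of_continuousOn hf.1.continuousOn).mul
      hω.integrable_weight_ofReal.aestronglyMeasurable) ?_
  filter_upwards [hω.ae_weight_nonneg] with ζ hζ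
  rw [norm_mul, Complex.norm_real, Real.norm_of_nonneg hζ, Pi.add_apply]
  nlinarith [sq_nonneg (‖f ζ‖ - 1), mul_nonneg (sq_nonneg (‖f ζ‖ - 1)) hζ,
    mul_nonneg (norm_nonneg (f ζ)) hζ]

theorem _root_.norm_ofReal_mul_exp {r : ℝ} (hr : 0 ≤ r) (θ : ℝ) :
    ‖(r : ℂ) * Complex.exp (θ * Complex.I)‖ = r := by
  rw [norm_mul, Complex.norm_exp_ofReal_mul_I, Complex.norm_real, Real.norm_of_nonneg hr, mul_one]

theorem _root_.conj_ofReal_mul_exp_pow (r θ : ℝ) (n : ℕ) :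
    conj ((r : ℂ) * Complex.exp (θ * Complex.I)) ^ n =
      (r : ℂ) ^ n * Complex.exp ((-n : ℤ) * θ * Complex.I) := by
  rw [map_mul, mul_pow, Complex.conj_ofReal, ← Complex.exp_conj, ← Complex.exp_nat_mul]
  congr 2
  simp
  ring

/-- The moments of an analytic function against `conj ζ ^ n` are its Taylor coefficients. -/
theorem integral_mul_weight_mul_conj_pow {f : ℂ → ℂ}
    (hf : DifferentiableOn ℂ f disc) (hfi : Integrable (fun ζ => f ζ * (ω ‖ζ‖ : ℂ)) dA) (n : ℕ) :
    ∫ ζ, f ζ * (ω ‖ζ‖ : ℂ) * conj ζ ^ n ∂dA =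
      2 * radialMoment ω (2 * n + 1) * ((n.factorial : ℂ)⁻¹ * iteratedDeriv n f 0) := by
  obtain ⟨α, hα⟩ : ∃ α : ℕ → ℂ, ∀ n, α n = (n.factorial : ℂ)⁻¹ * iteratedDeriv n f 0 :=
    ⟨_, fun _ => rfl⟩
  rw [← hα]
  have hsum : ∀ w ∈ disc, HasSum (fun n => α n * w ^ n) (f w) := fun w hw => by
    have := Complex.hasSum_taylorSeries_on_ball hf hw
    simp only [sub_zero, smul_eq_mul] at this
    convert! this using 2
    simp only [hα]
    ring
  rw [(integral_dA_polar (integrable_mul_conj_pow hfi n)).2, radialMoment,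
    intervalIntegral.integral_of_le zero_le_one, integral_Ioc_eq_integral_Ioo,
    Complex.real_smul]
  have key : ∀ r ∈ Ioo (0 : ℝ) 1, ∫ θ in Ioo (-Real.pi) Real.pi, r • (
      f (r * Complex.exp (θ * Complex.I)) * (ω ‖(r : ℂ) * Complex.exp (θ * Complex.I)‖ : ℂ) *
        conj ((r : ℂ) * Complex.exp (θ * Complex.I)) ^ n) =
      2 * Real.pi * α n * ((r ^ (2 * n + 1) * ω r : ℝ) : ℂ) := by
    intro r hr
    have hr' : (r : ℂ) ∈ disc := by
      rw [mem_disc, Complex.norm_real, Real.norm_of_nonneg hr.1.le]; exact hr.2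
    have ha : Summable fun k => ‖α k * (r : ℂ) ^ k‖ := (hsum _ hr').summable.norm
    have h := integral_tsum_mul_exp_neg ha n
    have hfr : ∀ θ : ℝ, f (r * Complex.exp (θ * Complex.I)) =
        ∑' k : ℕ, α k * (r : ℂ) ^ k * Complex.exp ((1 * k : ℤ) * θ * Complex.I) := fun θ => by
      rw [← (hsum _ (mem_disc.2 (by rw [norm_ofReal_mul_exp hr.1.le]; exact hr.2))).tsum_eq]
      congr 1 with k
      rw [mul_pow, ← Complex.exp_nat_mul, mul_assoc]
      congr 3
      push_cast
      ring
    have h2 : ∀ θ : ℝ, r • (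
      f (r * Complex.exp (θ * Complex.I)) * (ω ‖(r : ℂ) * Complex.exp (θ * Complex.I)‖ : ℂ) *
        conj ((r : ℂ) * Complex.exp (θ * Complex.I)) ^ n) = ((r * ω r * r ^ n : ℝ) : ℂ) *
        (Complex.exp ((-n : ℤ) * θ * Complex.I) *
          ∑' k : ℕ, α k * (r : ℂ) ^ k * Complex.exp ((1 * k : ℤ) * θ * Complex.I)) := fun θ => by
      rw [norm_ofReal_mul_exp hr.1.le, conj_ofReal_mul_exp_pow, hfr, Complex.real_smul]
      push_cast
      ring
    simp_rw [h2]
    rw [integral_const_mul, h]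
    push_cast
    ring
  rw [setIntegral_congr_fun measurableSet_Ioo key, integral_const_mul, integral_complex_ofReal]
  have : (Real.pi : ℂ) ≠ 0 := by exact_mod_cast Real.pi_ne_zero
  push_cast
  field_simp

theorem integral_mul_weight_mul_kernelSeries (hω : IsRadialWeight ω) {f : ℂ → ℂ}
    (hf : MemBergman ω f) {z : ℂ} (hz : z ∈ disc) :
    ∫ ζ, f ζ * (ω ‖ζ‖ : ℂ) * kernelSeries ω (z * conj ζ) ∂dA = f z := by
  have hi := hω.integrable_mul_weight hf
  refine (hω.hasSum_integral_mul_kernelSeries hi hz).unique ?_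
  have := Complex.hasSum_taylorSeries_on_ball hf.1 hz
  convert! this using 2 with n
  rw [integral_mul_weight_mul_conj_pow hf.1 hi n, kernelCoeff]
  have : (radialMoment ω (2 * n + 1) : ℂ) ≠ 0 := by
    exact_mod_cast (hω.radialMoment_pos _).ne'
  push_cast
  simp only [sub_zero, smul_eq_mul]
  field_simp

theorem memBergman_kernelSeries (hω : IsRadialWeight ω) {z : ℂ} (hz : z ∈ disc) :
    MemBergman ω (fun ζ => kernelSeries ω (conj z * ζ)) := by
  have hmem : ∀ ζ ∈ disc, conj z * ζ ∈ disc := fun ζ hζ => by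
    rw [mul_comm]; exact mul_conj_mem_disc hζ (mem_disc.1 hz).le
  have hd : DifferentiableOn ℂ (fun ζ => kernelSeries ω (conj z * ζ)) disc :=
    hω.differentiableOn_kernelSeries.comp (by fun_prop) hmem
  refine ⟨hd, ?_⟩
  refine hω.integrable_weight.bdd_mul (c := (∑' n, kernelCoeff ω n * ‖z‖ ^ n) ^ 2)
    ((aestronglyMeasurable_dA_of_continuousOn hd.continuousOn).norm.pow 2) ?_
  filter_upwards [ae_dA_mem_disc] with ζ hζ
  rw [norm_pow, norm_norm]
  have : ‖conj z * ζ‖ ≤ ‖z‖ := by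
    rw [norm_mul, RCLike.norm_conj]
    exact mul_le_of_le_one_right (norm_nonneg _) (mem_disc.1 hζ).le
  exact pow_le_pow_left₀ (norm_nonneg _) (hω.norm_kernelSeries_le hz this) 2

theorem isReproducingKernel_kernelSeries (hω : IsRadialWeight ω) :
    IsReproducingKernel ω (fun z ζ => kernelSeries ω (conj z * ζ)) := by
  refine fun z hz => ⟨hω.memBergman_kernelSeries hz, fun f hf => ?_⟩
  rw [← hω.integral_mul_weight_mul_kernelSeries hf hz]
  congr 1 with ζ
  rw [conj_kernelSeries, map_mul, Complex.conj_conj]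
  ring

/-- Reproducing `K z` and `L z` at `w`, and `L w` at `z` with either kernel, shows that both values
are the conjugate of `L w z`. This identifies the kernel picked by choice in `bergmanKernel` with
the series. -/
theorem _root_.IsReproducingKernel.eq {K L : ℂ → ℂ → ℂ} (hK : IsReproducingKernel ω K)
    (hL : IsReproducingKernel ω L) {z w : ℂ} (hz : z ∈ disc) (hw : w ∈ disc) : K z w = L z w := by
  have h2 := (hK z hz).2 (L w) (hL w hw).1
  have h3 := (hL z hz).2 (L w) (hL w hw).1
  have h1 := (hL w hw).2 (K z) (hK z hz).1
  have h4 := (hL w hw).2 (L z) (hL z hz).1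
  have e : ∀ f g : ℂ → ℂ, conj (∫ ζ, f ζ * conj (g ζ) * (ω ‖ζ‖ : ℂ) ∂dA) =
      ∫ ζ, g ζ * conj (f ζ) * (ω ‖ζ‖ : ℂ) ∂dA := fun f g => by
    rw [← integral_conj]
    congr 1 with ζ
    simp only [map_mul, Complex.conj_conj, Complex.conj_ofReal]
    ring
  rw [h1, h4, ← e (L w) (K z), ← e (L w) (L z), ← h2, ← h3]

theorem bergmanKernel_eq (hω : IsRadialWeight ω) {z ζ : ℂ} (hz : z ∈ disc) (hζ : ζ ∈ disc) :
    bergmanKernel ω z ζ = kernelSeries ω (conj z * ζ) := by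
  have h : ∃ K, IsReproducingKernel ω K := ⟨_, hω.isReproducingKernel_kernelSeries⟩
  rw [bergmanKernel, dif_pos h]
  exact h.choose_spec.eq hω.isReproducingKernel_kernelSeries hz hζ

theorem bergmanIntegrand_ae_eq (hω : IsRadialWeight ω) (f : ℂ → ℂ) {z : ℂ} (hz : z ∈ disc) :
    bergmanIntegrand ω f z =ᵐ[dA]
      fun ζ => f ζ * (ω ‖ζ‖ : ℂ) * kernelSeries ω (z * conj ζ) := by
  filter_upwards [ae_dA_mem_disc] with ζ hζ
  rw [bergmanIntegrand, hω.bergmanKernel_eq hz hζ, conj_kernelSeries, map_mul, Complex.conj_conj]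
  ring

theorem bergmanProj_eq (hω : IsRadialWeight ω) (f : ℂ → ℂ) {z : ℂ} (hz : z ∈ disc) :
    bergmanProj ω f z = ∫ ζ, f ζ * (ω ‖ζ‖ : ℂ) * kernelSeries ω (z * conj ζ) ∂dA :=
  integral_congr_ae (hω.bergmanIntegrand_ae_eq f hz)

theorem bergmanDefined_of_integrable (hω : IsRadialWeight ω) {f : ℂ → ℂ}
    (hf : Integrable (fun ζ => f ζ * (ω ‖ζ‖ : ℂ)) dA) : BergmanDefined ω f := fun _ hz =>
  (hω.integrable_mul_kernelSeries hf hz).congr (hω.bergmanIntegrand_ae_eq f hz).symm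

end IsRadialWeight

/-! ### Unboundedness into the weighted Hardy space. -/

theorem le_growthNorm_of_continuousOn {v : ℝ → ℝ} {G : ℂ → ℂ} (hG : ContinuousOn G disc)
    (hv : ContinuousOn v (Ico 0 1)) {z : ℂ} (hz : z ∈ disc) :
    ENNReal.ofReal (‖G z‖ * v ‖z‖) ≤ growthNorm v G := by
  set φ : ℂ → ℝ≥0∞ := fun z => ENNReal.ofReal (‖G z‖ * v ‖z‖) with hφ
  have hc : ContinuousOn φ disc := by
    refine ENNReal.continuous_ofReal.comp_continuousOn (hG.norm.mul ?_)
    exact hv.comp continuous_norm.continuousOn fun w hw => ⟨norm_nonneg _, mem_disc.1 hw⟩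
  by_contra! hlt
  -- The set where the essential supremum is exceeded is open and null, hence empty. This permits
  -- evaluation at a single point.
  have hopen : IsOpen (disc ∩ φ ⁻¹' Ioi (growthNorm v G)) :=
    hc.isOpen_inter_preimage isOpen_disc isOpen_Ioi
  have hae := (ae_restrict_iff' measurableSet_disc).1
    (ae_dA_iff.1 (ENNReal.ae_le_essSup (μ := dA) φ))
  have h0 : volume (disc ∩ φ ⁻¹' Ioi (growthNorm v G)) = 0 := by
    refine measure_mono_null ?_ (ae_iff.1 hae)
    intro w hw h
    exact absurd (h hw.1) (not_le.2 hw.2)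
  rw [hopen.measure_eq_zero_iff volume] at h0
  exact (h0.le ⟨hz, hlt⟩ : z ∈ (∅ : Set ℂ))

theorem integral_mul_exp_neg_mul_I {m : ℕ} (hm : m ≠ 0) :
    ∫ θ in Ioo (-Real.pi) Real.pi, (θ : ℂ) * Complex.exp ((-m : ℤ) * θ * Complex.I) =
      2 * Real.pi * Complex.I * (-1) ^ m / m := by
  have hm' : (m : ℂ) ≠ 0 := by exact_mod_cast hm
  rw [← integral_Ioc_eq_integral_Ioo, ← intervalIntegral.integral_of_le (by linarith [Real.pi_pos])]
  -- Antiderivative found by integrating by parts once.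
  have hd : ∀ θ : ℝ, HasDerivAt (fun θ : ℝ => (θ * (Complex.I / m) + 1 / m ^ 2) *
      Complex.exp ((-m : ℤ) * θ * Complex.I))
      ((θ : ℂ) * Complex.exp ((-m : ℤ) * θ * Complex.I)) θ := fun θ => by
    have hid : HasDerivAt (fun θ : ℝ => (θ : ℂ)) 1 θ := Complex.ofRealCLM.hasDerivAt
    have h1 := ((hid.mul_const (Complex.I / m)).add_const (1 / (m : ℂ) ^ 2)).mul
      (((hid.const_mul ((-m : ℤ) : ℂ)).mul_const Complex.I).cexp)
    convert! h1 using 1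
    push_cast
    field_simp
    ring_nf
    rw [Complex.I_sq]
    ring
  rw [intervalIntegral.integral_eq_sub_of_hasDerivAt (fun θ _ => hd θ)
    (Continuous.intervalIntegrable (by fun_prop) _ _)]
  have e1 : Complex.exp ((-m : ℤ) * (Real.pi : ℝ) * Complex.I) = (-1) ^ m := by
    rw [show ((-m : ℤ) * (Real.pi : ℝ) * Complex.I : ℂ) = m * -(Real.pi * Complex.I) by
      push_cast; ring, Complex.exp_nat_mul, Complex.exp_neg, Complex.exp_pi_mul_I]
    norm_num
  have e2 : Complex.exp ((-m : ℤ) * (-Real.pi : ℝ) * Complex.I) = (-1) ^ m := by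
    rw [show ((-m : ℤ) * (-Real.pi : ℝ) * Complex.I : ℂ) = m * (Real.pi * Complex.I) by
      push_cast; ring, Complex.exp_nat_mul, Complex.exp_pi_mul_I]
  rw [e1, e2]
  push_cast
  ring

/-- The function on which the Bergman projection is large: a discontinuous angular factor, cut off
inside the circle of radius `s`. -/
noncomputable def angularTest (s a : ℝ) (ζ : ℂ) : ℂ :=
  if s ≤ ‖ζ‖ then (a : ℂ) * (ζ.arg : ℂ) * conj ζ else 0

theorem measurable_angularTest (s a : ℝ) : Measurable (angularTest s a) := by
  refine Measurable.ite (measurableSet_le measurable_const measurable_norm) ?_ measurable_const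
  exact (measurable_const.mul (Complex.measurable_ofReal.comp Complex.measurable_arg)).mul
    Complex.continuous_conj.measurable

theorem norm_angularTest_le {s a : ℝ} (ha : 0 ≤ a) {ζ : ℂ} (hζ : ζ ∈ disc) :
    ‖angularTest s a ζ‖ ≤ a * Real.pi := by
  unfold angularTest
  have := Real.pi_pos
  split_ifs
  · rw [norm_mul, norm_mul, RCLike.norm_conj, Complex.norm_real, Complex.norm_real,
      Real.norm_of_nonneg ha, Real.norm_eq_abs]
    have h1 := Complex.abs_arg_le_pi ζ
    calc a * |ζ.arg| * ‖ζ‖ ≤ a * Real.pi * 1 := by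
          have := (mem_disc.1 hζ).le
          gcongr
      _ = _ := mul_one _
  · rw [norm_zero]; positivity

namespace IsRadialWeight

variable {ω ν : ℝ → ℝ}

theorem integrable_angularTest_mul (hω : IsRadialWeight ω) (s : ℝ) {a : ℝ} (ha : 0 ≤ a) :
    Integrable (fun ζ => angularTest s a ζ * (ω ‖ζ‖ : ℂ)) dA := by
  refine hω.integrable_weight_ofReal.bdd_mul (c := a * Real.pi)
    (measurable_angularTest s a).aestronglyMeasurable ?_
  filter_upwards [ae_dA_mem_disc] with ζ hζ
  exact norm_angularTest_le ha hζ

theorem growthNorm_angularTest_le (hν : IsRadialWeight ν) {s : ℝ} (hs : s ∈ Ico (0 : ℝ) 1) :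
    growthNorm (tail ν) (angularTest s (tail ν s)⁻¹) ≤ ENNReal.ofReal Real.pi := by
  refine essSup_le_of_ae_le _ ?_
  filter_upwards [ae_dA_mem_disc] with ζ hζ
  refine ENNReal.ofReal_le_ofReal ?_
  have hsp := hν.tail_pos s hs
  rcases le_or_gt s ‖ζ‖ with h | h
  · calc _ ≤ (tail ν s)⁻¹ * Real.pi * tail ν s := by
          have := (hν.tail_pos _ (norm_mem_Ico hζ)).le
          have h1 := norm_angularTest_le (s := s) (inv_pos.2 hsp).le hζ
          have h2 := hν.tail_anti hs.1 h (mem_disc.1 hζ).le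
          have := Real.pi_pos
          gcongr
      _ = Real.pi := by field_simp
  · rw [angularTest, if_neg (not_le.2 h)]
    simp [Real.pi_pos.le]

/-- The factor `conj ζ` in `angularTest` shifts the frequency to `n + 1`, so the vanishing mean of
the sawtooth never occurs and the formula is uniform in `n`. The power `r^(n+2)` collects `r^n`,
this extra factor, and the polar Jacobian. -/
theorem integral_angularTest_mul_conj_pow (hω : IsRadialWeight ω) {s a : ℝ}
    (hs : s ∈ Ico (0 : ℝ) 1) (ha : 0 ≤ a) (n : ℕ) :
    ∫ ζ, angularTest s a ζ * (ω ‖ζ‖ : ℂ) * conj ζ ^ n ∂dA =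
      2 * Complex.I * (-1) ^ (n + 1) / (n + 1) * a * ((∫ r in s..1, r ^ (n + 2) * ω r : ℝ) : ℂ) := by
  rw [(integral_dA_polar (integrable_mul_conj_pow (hω.integrable_angularTest_mul s ha) n)).2,
    Complex.real_smul]
  have key : ∀ r ∈ Ioo (0 : ℝ) 1, ∫ θ in Ioo (-Real.pi) Real.pi, r • (
      angularTest s a (r * Complex.exp (θ * Complex.I)) *
        (ω ‖(r : ℂ) * Complex.exp (θ * Complex.I)‖ : ℂ) *
        conj ((r : ℂ) * Complex.exp (θ * Complex.I)) ^ n) =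
      2 * Real.pi * Complex.I * (-1) ^ (n + 1) / (n + 1) * a *
        (((Ici s).indicator (fun r => r ^ (n + 2) * ω r) r : ℝ) : ℂ) := by
    intro r hr
    have h2 : ∀ θ ∈ Ioo (-Real.pi) Real.pi, r • (
      angularTest s a (r * Complex.exp (θ * Complex.I)) *
        (ω ‖(r : ℂ) * Complex.exp (θ * Complex.I)‖ : ℂ) *
        conj ((r : ℂ) * Complex.exp (θ * Complex.I)) ^ n) =
        a * (((Ici s).indicator (fun r => r ^ (n + 2) * ω r) r : ℝ) : ℂ) *
        ((θ : ℂ) * Complex.exp ((-(n + 1 : ℕ) : ℤ) * θ * Complex.I)) := by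
      intro θ hθ
      have harg : Complex.arg (r * Complex.exp (θ * Complex.I)) = θ := by
        rw [Complex.exp_mul_I]
        exact Complex.arg_mul_cos_add_sin_mul_I hr.1 (Ioo_subset_Ioc_self hθ)
      rw [norm_ofReal_mul_exp hr.1.le, angularTest, norm_ofReal_mul_exp hr.1.le, harg,
        Complex.real_smul]
      by_cases h : s ≤ r
      · rw [if_pos h, indicator_of_mem (show r ∈ Ici s from h)]
        have := conj_ofReal_mul_exp_pow r θ (n + 1)
        rw [pow_succ] at this
        push_cast at this ⊢
        linear_combination (r : ℂ) * ω r * a * θ * this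
      · rw [if_neg h, indicator_of_notMem (show r ∉ Ici s from h)]
        simp
    rw [setIntegral_congr_fun measurableSet_Ioo h2, integral_const_mul,
      integral_mul_exp_neg_mul_I (m := n + 1) n.succ_ne_zero]
    push_cast
    ring
  rw [setIntegral_congr_fun measurableSet_Ioo key, integral_const_mul, integral_complex_ofReal,
    setIntegral_indicator measurableSet_Ici]
  have hset : ∫ r in Ioo (0 : ℝ) 1 ∩ Ici s, r ^ (n + 2) * ω r = ∫ r in s..1, r ^ (n + 2) * ω r := by
    rw [intervalIntegral.integral_of_le hs.2.le, integral_Ioc_eq_integral_Ioo]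
    refine setIntegral_congr_set ?_
    have h1 : (Ioo (0 : ℝ) 1 ∩ Ici s : Set ℝ) =ᵐ[volume] (Ioo (0 : ℝ) 1 ∩ Ioi s : Set ℝ) :=
      (ae_eq_refl _).inter Ioi_ae_eq_Ici.symm
    refine h1.trans (Eq.eventuallyEq ?_)
    ext x
    exact ⟨fun h => ⟨h.2, h.1.2⟩, fun h => ⟨⟨hs.1.trans_lt h.1, h.2⟩, h.1⟩⟩
  rw [hset]
  have : (Real.pi : ℂ) ≠ 0 := by exact_mod_cast Real.pi_ne_zero
  push_cast
  field_simp

/-- At `-s` the sign `(-1)^n` of the power cancels that of the moment, so after multiplication by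
`I` every term is nonnegative and partial sums are lower bounds. -/
theorem sum_le_norm_bergmanProj_angularTest (hω : IsRadialWeight ω) {s a : ℝ}
    (hs : s ∈ Ico (0 : ℝ) 1) (ha : 0 ≤ a) (F : Finset ℕ) :
    a * tail ω s * ∑ n ∈ F, 2 * kernelCoeff ω n * s ^ (2 * n + 2) / (n + 1) ≤
      ‖bergmanProj ω (angularTest s a) (-s)‖ := by
  have hz : (-s : ℂ) ∈ disc := by
    rw [mem_disc, norm_neg, Complex.norm_real, Real.norm_of_nonneg hs.1]; exact hs.2
  have h := hω.hasSum_integral_mul_kernelSeries (hω.integrable_angularTest_mul s ha) hz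
  rw [← hω.bergmanProj_eq _ hz] at h
  set J : ℕ → ℝ := fun n => ∫ r in s..1, r ^ (n + 2) * ω r with hJ
  have hterm : ∀ n : ℕ, Complex.I * ((kernelCoeff ω n : ℂ) * (-s : ℂ) ^ n *
      ∫ ζ, angularTest s a ζ * (ω ‖ζ‖ : ℂ) * conj ζ ^ n ∂dA) =
      ((2 * kernelCoeff ω n * s ^ n * a * J n / (n + 1) : ℝ) : ℂ) := fun n => by
    rw [hω.integral_angularTest_mul_conj_pow hs ha, neg_pow]
    have h1 : ((-1 : ℂ) ^ n) * (-1) ^ n = 1 := by rw [← mul_pow]; norm_num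
    have h2 := Complex.I_mul_I
    push_cast
    calc _ = -(Complex.I * Complex.I) * ((-1 : ℂ) ^ n * (-1) ^ n) *
          (2 * kernelCoeff ω n * s ^ n * a * J n / (n + 1)) := by rw [pow_succ]; ring
      _ = _ := by rw [h1, h2]; ring
  have h' := h.mul_left Complex.I
  simp_rw [hterm] at h'
  have h3 := (Complex.hasSum_re h')
  simp only [Complex.ofReal_re] at h3
  have hpos := hω.tail_pos s hs
  have hJle : ∀ n, s ^ (n + 2) * tail ω s ≤ J n := fun n =>
    hω.pow_mul_tail_le_integral (n + 2) ⟨hs.1, hs.2.le⟩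
  have hs0 := hs.1
  calc _ = ∑ n ∈ F, 2 * kernelCoeff ω n * s ^ n * a * (s ^ (n + 2) * tail ω s) / (n + 1) := by
        rw [Finset.mul_sum]
        refine Finset.sum_congr rfl fun n _ => ?_
        ring
    _ ≤ ∑ n ∈ F, 2 * kernelCoeff ω n * s ^ n * a * J n / (n + 1) := by
        refine Finset.sum_le_sum fun n _ => ?_
        have := (hω.kernelCoeff_pos n).le
        have := hJle n
        gcongr
    _ ≤ _ := sum_le_hasSum F (fun n _ => by
        have := (hω.kernelCoeff_pos n).le
        have : 0 ≤ J n := (by positivity : 0 ≤ s ^ (n + 2) * tail ω s).trans (hJle n)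
        positivity) h3
    _ ≤ ‖Complex.I * bergmanProj ω (angularTest s a) (-s)‖ := Complex.re_le_norm _
    _ = _ := by rw [norm_mul, Complex.norm_I, one_mul]

/-- The amplitude `1/ν̂(s)` of the test function meets the weight `ν̂(s)` at the evaluation point,
and `ν` disappears from the estimate. -/
theorem exists_tail_mul_sum_le (hω : IsRadialWeight ω) (hν : IsRadialWeight ν)
    (hb : BergmanBoundedOnDomainToHardy ω (tail ν)) :
    ∃ A : ℝ, 0 < A ∧ ∀ s ∈ Ico (0 : ℝ) 1, ∀ F : Finset ℕ,
      tail ω s * ∑ n ∈ F, 2 * kernelCoeff ω n * s ^ (2 * n + 2) / (n + 1) ≤ A := by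
  obtain ⟨C, hC⟩ := hb
  refine ⟨C * Real.pi + 1, by positivity, fun s hs F => ?_⟩
  have hsp := hν.tail_pos s hs
  have hz : (-s : ℂ) ∈ disc := by
    rw [mem_disc, norm_neg, Complex.norm_real, Real.norm_of_nonneg hs.1]; exact hs.2
  have hgn := hν.growthNorm_angularTest_le hs
  obtain ⟨h1, h2⟩ := hC (angularTest s (tail ν s)⁻¹)
    ⟨(measurable_angularTest _ _).aestronglyMeasurable, hgn.trans_lt ENNReal.ofReal_lt_top⟩
    (hω.bergmanDefined_of_integrable (hω.integrable_angularTest_mul s (inv_pos.2 hsp).le))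
  have h3 := (le_growthNorm_of_continuousOn h1.1.continuousOn
    (hν.continuousOn_tail.mono Ico_subset_Icc_self) hz).trans
    (h2.trans (mul_le_mul_right hgn _))
  rw [← ENNReal.ofReal_coe_nnreal, ← ENNReal.ofReal_mul C.coe_nonneg,
    ENNReal.ofReal_le_ofReal_iff (mul_nonneg C.coe_nonneg Real.pi_pos.le), norm_neg, Complex.norm_real,
    Real.norm_of_nonneg hs.1] at h3
  have h4 := hω.sum_le_norm_bergmanProj_angularTest hs (inv_pos.2 hsp).le F
  have h5 := (mul_le_mul_of_nonneg_right h4 hsp.le).trans h3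
  calc _ = (tail ν s)⁻¹ * tail ω s * (∑ n ∈ F, 2 * kernelCoeff ω n * s ^ (2 * n + 2) / (n + 1)) *
        tail ν s := by field_simp
    _ ≤ C * Real.pi := h5
    _ ≤ _ := by linarith

/-- Each of the `J` dyadic blocks contributes at least `1/2`. -/
theorem _root_.half_natCast_le_sum_Ico_inv {M : ℕ} (hM : 0 < M) (J : ℕ) :
    (J : ℝ) / 2 ≤ ∑ n ∈ Finset.Ico M (M * 2 ^ J), 1 / ((n : ℝ) + 1) := by
  induction J with
  | zero => simp
  | succ J ih =>
    have h1 : M ≤ M * 2 ^ J := Nat.le_mul_of_pos_right _ (by positivity)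
    have h2 : M * 2 ^ J ≤ M * 2 ^ (J + 1) := by gcongr <;> simp
    rw [← Finset.sum_Ico_consecutive _ h1 h2]
    have hpos : (0 : ℝ) < M * 2 ^ J := by positivity
    have h3 : (1 : ℝ) / 2 ≤ ∑ n ∈ Finset.Ico (M * 2 ^ J) (M * 2 ^ (J + 1)), 1 / ((n : ℝ) + 1) := by
      have := Finset.card_nsmul_le_sum (Finset.Ico (M * 2 ^ J) (M * 2 ^ (J + 1)))
        (fun n => 1 / ((n : ℝ) + 1)) (1 / (2 * (M * 2 ^ J))) fun n hn => by
          have : n + 1 ≤ M * 2 ^ (J + 1) := (Finset.mem_Ico.1 hn).2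
          have : (n : ℝ) + 1 ≤ M * 2 ^ (J + 1) := by exact_mod_cast this
          refine one_div_le_one_div_of_le (by positivity) (this.trans (le_of_eq (by ring)))
      rw [Nat.card_Ico, show M * 2 ^ (J + 1) - M * 2 ^ J = M * 2 ^ J by
        rw [pow_succ, ← mul_assoc]; generalize M * 2 ^ J = q; omega, nsmul_eq_mul] at this
      refine le_trans (le_of_eq ?_) this
      push_cast
      field_simp
    push_cast
    linarith

theorem _root_.exp_neg_two_mul_le_one_sub {x : ℝ} (h0 : 0 ≤ x) (h1 : x ≤ 1 / 2) :
    Real.exp (-(2 * x)) ≤ 1 - x := by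
  rw [Real.exp_neg, inv_le_comm₀ (Real.exp_pos _) (by linarith)]
  refine le_trans ?_ (Real.add_one_le_exp _)
  rw [inv_le_iff_one_le_mul₀ (by linarith)]
  nlinarith

theorem lowerDoubling_of_tail_mul_sum_le (hω : IsRadialWeight ω) (hup : UpperDoubling ω) {A : ℝ}
    (hA : 0 < A) (h : ∀ s ∈ Ico (0 : ℝ) 1, ∀ F : Finset ℕ,
      tail ω s * ∑ n ∈ F, 2 * kernelCoeff ω n * s ^ (2 * n + 2) / (n + 1) ≤ A) :
    LowerDoubling ω := by
  obtain ⟨D, hD, hDn⟩ := hω.exists_radialMoment_le hup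
  -- The terms below are at least `exp(-8) / (D ω̂(r))` times `1/(n+1)`, and the harmonic sum is at
  -- least `J/2`; this `J` turns the bound `A` into `2 ω̂(s) ≤ ω̂(r)`.
  obtain ⟨J, hJ⟩ := exists_nat_ge (4 * D * A * Real.exp 8)
  have hJ0 : J ≠ 0 := by
    rintro rfl
    have : 0 < 4 * D * A * Real.exp 8 := by positivity
    simp only [Nat.cast_zero] at hJ
    linarith
  have hK : (1 : ℝ) < 2 ^ J := one_lt_pow₀ one_lt_two hJ0
  refine ⟨2 ^ J, 2, hK, one_lt_two, ?_⟩
  filter_upwards [Ioo_mem_nhdsLT (show (1 / 2 : ℝ) < 1 by norm_num)] with r hr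
  set δ : ℝ := 1 - r with hδ
  have hδ0 : 0 < δ := by linarith [hr.2]
  have hδ1 : δ ≤ 1 / 2 := by linarith [hr.1]
  have hx0 : 0 < δ / 2 ^ J := by positivity
  have hx1 : δ / 2 ^ J ≤ 1 / 2 := (div_le_self hδ0.le hK.le).trans hδ1
  set s : ℝ := 1 - δ / 2 ^ J with hsdef
  have hs : s ∈ Ico (0 : ℝ) 1 := ⟨by linarith, by linarith⟩
  have hrp := hω.tail_pos r ⟨by linarith [hr.1], hr.2⟩
  have hsp := hω.tail_pos s hs
  -- From index `M` on, `1 - 1/(2n+1) ≥ r`, so the moments are at most `D ω̂(r)`.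
  set M := ⌈1 / δ⌉₊ with hM
  have hM1 : 1 / δ ≤ M := Nat.le_ceil _
  have hM2 : (M : ℝ) < 1 / δ + 1 := Nat.ceil_lt_add_one (by positivity)
  have hM0 : 0 < M := Nat.ceil_pos.2 (by positivity)
  have hMδ : (M : ℝ) * δ ≤ 2 := by
    have : (M : ℝ) * δ ≤ (1 / δ + 1) * δ := by gcongr
    rw [add_mul, one_div_mul_cancel hδ0.ne'] at this
    linarith
  have hterm : ∀ n ∈ Finset.Ico M (M * 2 ^ J),
      Real.exp (-8) / (D * tail ω r) * (1 / ((n : ℝ) + 1)) ≤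
        2 * kernelCoeff ω n * s ^ (2 * n + 2) / (n + 1) := by
    intro n hn
    obtain ⟨hn1, hn2⟩ := Finset.mem_Ico.1 hn
    have hcoef : 1 / (D * tail ω r) ≤ 2 * kernelCoeff ω n := by
      have e : 2 * kernelCoeff ω n = 1 / radialMoment ω (2 * n + 1) := by
        have := (hω.radialMoment_pos (2 * n + 1)).ne'
        rw [kernelCoeff]; field_simp
      rw [e]
      refine one_div_le_one_div_of_le (hω.radialMoment_pos _) ?_
      refine (hDn (2 * n + 1) (by omega)).trans ?_
      have hle : 1 / ((2 * n + 1 : ℕ) : ℝ) ≤ δ := by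
        rw [one_div_le (by positivity) hδ0]
        refine hM1.trans ?_
        exact_mod_cast (by omega : M ≤ 2 * n + 1)
      have hpos : 0 < 1 / ((2 * n + 1 : ℕ) : ℝ) := by positivity
      refine mul_le_mul_of_nonneg_left (hω.tail_anti (by linarith [hr.1]) ?_ ?_) hD.le
      · linarith
      · linarith
    -- The exponent is at most `2 M 2^J` and `s ≥ exp(-2δ/2^J)`; with `M δ ≤ 2` the total is `4 M δ
    -- ≤ 8`.
    have hpow : Real.exp (-8) ≤ s ^ (2 * n + 2) := by
      have h1 : s ^ (2 * (M * 2 ^ J)) ≤ s ^ (2 * n + 2) :=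
        pow_le_pow_of_le_one hs.1 hs.2.le (by omega)
      refine le_trans ?_ h1
      have h2 := pow_le_pow_left₀ (Real.exp_pos _).le (exp_neg_two_mul_le_one_sub hx0.le hx1)
        (2 * (M * 2 ^ J))
      refine le_trans ?_ h2
      rw [← Real.exp_nat_mul]
      refine Real.exp_le_exp.2 ?_
      have e : ((2 * (M * 2 ^ J) : ℕ) : ℝ) * -(2 * (δ / 2 ^ J)) = -(4 * (M * δ)) := by
        push_cast
        field_simp
        ring
      rw [e]
      linarith
    calc _ = 1 / (D * tail ω r) * Real.exp (-8) / (n + 1) := by ring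
      _ ≤ _ := by
        have := (hω.kernelCoeff_pos n).le
        have := Real.exp_pos (-8)
        gcongr
  have h1 := h s hs (Finset.Ico M (M * 2 ^ J))
  have h2 := Finset.sum_le_sum hterm
  rw [← Finset.mul_sum] at h2
  have h3 := half_natCast_le_sum_Ico_inv hM0 J
  have h4 : tail ω s * (Real.exp (-8) / (D * tail ω r) * ((4 * D * A * Real.exp 8) / 2)) ≤ A := by
    refine le_trans ?_ h1
    refine mul_le_mul_of_nonneg_left (le_trans ?_ h2) hsp.le
    have : 0 < Real.exp (-8) / (D * tail ω r) := by positivity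
    refine mul_le_mul_of_nonneg_left (le_trans ?_ h3) this.le
    linarith
  have e : tail ω s * (Real.exp (-8) / (D * tail ω r) * ((4 * D * A * Real.exp 8) / 2)) =
      2 * tail ω s / tail ω r * A := by
    rw [Real.exp_neg]
    field_simp
    ring
  rw [e] at h4
  have h5 : 2 * tail ω s / tail ω r ≤ 1 := by
    by_contra! hlt
    have := mul_lt_mul_of_pos_right hlt hA
    linarith
  exact (div_le_one hrp).1 h5

/-- The Bergman projection is not bounded into a weighted `H^∞` space unless the lower doubling
condition holds. -/
theorem not_bergmanBoundedOnDomainToHardy (hω : IsRadialWeight ω) (hup : UpperDoubling ω)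
    (hlow : ¬ LowerDoubling ω) (hν : IsRadialWeight ν) :
    ¬ BergmanBoundedOnDomainToHardy ω (tail ν) := fun hb => by
  obtain ⟨A, hA, h⟩ := hω.exists_tail_mul_sum_le hν hb
  exact hlow (hω.lowerDoubling_of_tail_mul_sum_le hup hA h)

end IsRadialWeight

/-! ### The companion weight with tail comparable to the square root. -/

namespace IsRadialWeight

variable {ω ν : ℝ → ℝ}

theorem continuousOn_sqrt_tail (hω : IsRadialWeight ω) :
    ContinuousOn (fun r => √(tail ω r)) (Icc 0 1) := hω.continuousOn_tail.sqrt

theorem intervalIntegrable_sqrt_tail (hω : IsRadialWeight ω) {a b : ℝ} (ha : a ∈ Icc (0 : ℝ) 1)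
    (hb : b ∈ Icc (0 : ℝ) 1) : IntervalIntegrable (fun r => √(tail ω r)) volume a b :=
  (hω.continuousOn_sqrt_tail.mono (uIcc_subset_Icc ha hb)).intervalIntegrable

theorem integral_sqrt_tail_le (hω : IsRadialWeight ω) {a b c : ℝ} (ha : 0 ≤ a) (hca : 0 ≤ c)
    (hc : c ≤ a) (hab : a ≤ b) (hb : b ≤ 1) :
    ∫ r in a..b, √(tail ω r) ≤ (b - a) * √(tail ω c) := by
  rw [← smul_eq_mul, ← intervalIntegral.integral_const]
  refine intervalIntegral.integral_mono_on hab (hω.intervalIntegrable_sqrt_tail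
    ⟨ha, hab.trans hb⟩ ⟨ha.trans hab, hb⟩) (by simp) fun x hx => ?_
  exact Real.sqrt_le_sqrt (hω.tail_anti hca (hc.trans hx.1) (hx.2.trans hb))

theorem le_integral_sqrt_tail (hω : IsRadialWeight ω) {a b : ℝ} (ha : 0 ≤ a) (hab : a ≤ b)
    (hb : b ≤ 1) : (b - a) * √(tail ω b) ≤ ∫ r in a..b, √(tail ω r) := by
  rw [← smul_eq_mul, ← intervalIntegral.integral_const]
  refine intervalIntegral.integral_mono_on hab (by simp) (hω.intervalIntegrable_sqrt_tail
    ⟨ha, hab.trans hb⟩ ⟨ha.trans hab, hb⟩) fun x hx => ?_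
  exact Real.sqrt_le_sqrt (hω.tail_anti (ha.trans hx.1) hx.2 hb)

/-- The average of the square root of the tail over `[r, 1]`. -/
noncomputable def _root_.sqrtTailAverage (ω : ℝ → ℝ) (r : ℝ) : ℝ :=
  (1 - r)⁻¹ * ∫ t in r..1, √(tail ω t)

theorem sqrtTailAverage_le (hω : IsRadialWeight ω) {r : ℝ} (hr : r ∈ Ico (0 : ℝ) 1) :
    sqrtTailAverage ω r ≤ √(tail ω r) := by
  have h : 0 < 1 - r := by linarith [hr.2]
  rw [sqrtTailAverage, inv_mul_le_iff₀ h]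
  exact hω.integral_sqrt_tail_le hr.1 hr.1 le_rfl hr.2.le le_rfl

theorem sqrtTailAverage_nonneg (hω : IsRadialWeight ω) {r : ℝ} (hr : r ∈ Ico (0 : ℝ) 1) :
    0 ≤ sqrtTailAverage ω r := by
  have h : 0 < 1 - r := by linarith [hr.2]
  refine mul_nonneg (inv_pos.2 h).le ?_
  have := hω.le_integral_sqrt_tail hr.1 hr.2.le le_rfl
  rw [tail_one, Real.sqrt_zero, mul_zero] at this
  exact this

/-- Only the left half of `[r, 1]` is kept, where `√ω̂` is at least its value at the midpoint. -/
theorem half_sqrt_tail_le_sqrtTailAverage (hω : IsRadialWeight ω) {r : ℝ}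
    (hr : r ∈ Ico (0 : ℝ) 1) : √(tail ω ((1 + r) / 2)) / 2 ≤ sqrtTailAverage ω r := by
  have h : 0 < 1 - r := by linarith [hr.2]
  have hm0 : 0 ≤ (1 + r) / 2 := by linarith [hr.1]
  have hm1 : (1 + r) / 2 ≤ 1 := by linarith [hr.2]
  rw [sqrtTailAverage, le_inv_mul_iff₀ h]
  have h1 := hω.le_integral_sqrt_tail hr.1 (by linarith [hr.2] : r ≤ (1 + r) / 2) hm1
  have h2 := hω.le_integral_sqrt_tail hm0 hm1 le_rfl
  rw [tail_one, Real.sqrt_zero, mul_zero] at h2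
  have h3 := intervalIntegral.integral_add_adjacent_intervals
    (hω.intervalIntegrable_sqrt_tail (a := r) (b := (1 + r) / 2) ⟨hr.1, hr.2.le⟩ ⟨hm0, hm1⟩)
    (hω.intervalIntegrable_sqrt_tail (b := 1) ⟨hm0, hm1⟩ (by simp))
  rw [← h3]
  calc _ = ((1 + r) / 2 - r) * √(tail ω ((1 + r) / 2)) := by ring
    _ ≤ _ := by linarith

theorem continuousOn_sqrtTailAverage (hω : IsRadialWeight ω) :
    ContinuousOn (sqrtTailAverage ω) (Icc 0 1) := by
  have hP : ContinuousOn (fun r => ∫ t in r..1, √(tail ω t)) (Icc 0 1) := by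
    have := intervalIntegral.continuousOn_primitive_interval_left (μ := volume)
      (f := fun r => √(tail ω r)) (a := 0) (b := 1)
      (by rw [uIcc_of_le zero_le_one]; exact hω.continuousOn_sqrt_tail.integrableOn_Icc)
    rwa [uIcc_of_le (zero_le_one' ℝ)] at this
  intro r hr
  rcases hr.2.lt_or_eq with h | rfl
  · refine ContinuousWithinAt.mul ?_ (hP r hr)
    exact ContinuousWithinAt.inv₀ (by fun_prop) (by linarith)
  -- With `0⁻¹ = 0` the value at `1` is `0`, which is the true limit: the average is squeezed
  -- between `0` and `√ω̂`.
  · have h0 : sqrtTailAverage ω 1 = 0 := by simp [sqrtTailAverage]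
    have ht := (hω.continuousOn_sqrt_tail 1 hr)
    unfold ContinuousWithinAt at *
    simp only [tail_one, Real.sqrt_zero] at ht
    rw [h0]
    refine tendsto_of_tendsto_of_tendsto_of_le_of_le' tendsto_const_nhds ht ?_ ?_
    all_goals
      filter_upwards [self_mem_nhdsWithin] with x hx
      rcases hx.2.lt_or_eq with h | rfl
    · exact hω.sqrtTailAverage_nonneg ⟨hx.1, h⟩
    · exact h0.ge
    · exact hω.sqrtTailAverage_le ⟨hx.1, h⟩
    · rw [h0]; positivity

theorem hasDerivAt_neg_sqrtTailAverage (hω : IsRadialWeight ω) {r : ℝ} (hr : r ∈ Ioo (0 : ℝ) 1) :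
    HasDerivAt (fun r => -sqrtTailAverage ω r)
      ((√(tail ω r) - sqrtTailAverage ω r) / (1 - r)) r := by
  have h : 1 - r ≠ 0 := by linarith [hr.2]
  have hc : ContinuousAt (fun r => √(tail ω r)) r :=
    hω.continuousOn_sqrt_tail.continuousAt (Icc_mem_nhds hr.1 hr.2)
  have hm : StronglyMeasurableAtFilter (fun r => √(tail ω r)) (𝓝 r) volume :=
    ContinuousOn.stronglyMeasurableAtFilter isOpen_Ioo
      (hω.continuousOn_sqrt_tail.mono Ioo_subset_Icc_self) r hr
  have h1 := intervalIntegral.integral_hasDerivAt_left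
    (hω.intervalIntegrable_sqrt_tail (b := 1) (Ioo_subset_Icc_self hr) (by simp)) hm hc
  have h2 : HasDerivAt (fun r : ℝ => (1 - r)⁻¹) (-(-1) / (1 - r) ^ 2) r :=
    ((hasDerivAt_id r).const_sub 1).inv h
  convert! (h2.mul h1).neg using 1
  rw [sqrtTailAverage]
  field_simp
  ring

/-- Every weight in the upper doubling class has a companion whose tail is comparable to the square
root of its tail. -/
theorem exists_tailComparableSqrt (hω : IsRadialWeight ω) (hup : UpperDoubling ω) :
    ∃ ν : ℝ → ℝ, IsRadialWeight ν ∧ TailComparableSqrt ν ω := by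
  obtain ⟨C, hC, h⟩ := hω.exists_doubling hup
  -- Minus the derivative of the average; it is nonnegative because the average of a decreasing
  -- function is at most its left endpoint value.
  set ν : ℝ → ℝ := fun r => (√(tail ω r) - sqrtTailAverage ω r) / (1 - r) with hν
  have hnn : ∀ r ∈ Ico (0 : ℝ) 1, 0 ≤ ν r := fun r hr =>
    div_nonneg (sub_nonneg.2 (hω.sqrtTailAverage_le hr)) (by linarith [hr.2])
  -- Integrability up to `1` comes from the sign of the derivative and continuity of the primitive.
  have hint : IntegrableOn ν (Ioc 0 1) :=
    intervalIntegral.integrableOn_deriv_of_nonneg hω.continuousOn_sqrtTailAverage.neg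
      (fun r hr => hω.hasDerivAt_neg_sqrtTailAverage hr)
      fun r hr => hnn r (Ioo_subset_Ico_self hr)
  have htail : ∀ r ∈ Ico (0 : ℝ) 1, tail ν r = sqrtTailAverage ω r := fun r hr => by
    rw [tail, intervalIntegral.integral_eq_sub_of_hasDerivAt_of_le hr.2.le
      (f := fun r => -sqrtTailAverage ω r)
      (hω.continuousOn_sqrtTailAverage.neg.mono (Icc_subset_Icc_left hr.1))
      (fun x hx => hω.hasDerivAt_neg_sqrtTailAverage ⟨hr.1.trans_lt hx.1, hx.2⟩)
      ((intervalIntegrable_iff_integrableOn_Ioc_of_le hr.2.le).2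
        (hint.mono_set (Ioc_subset_Ioc_left hr.1)))]
    simp [sqrtTailAverage]
  have hlow : ∀ r ∈ Ico (0 : ℝ) 1, (2 * √C)⁻¹ * √(tail ω r) ≤ sqrtTailAverage ω r := fun r hr => by
    have hC0 : 0 < √C := Real.sqrt_pos.2 (by linarith)
    refine le_trans ?_ (hω.half_sqrt_tail_le_sqrtTailAverage hr)
    have h1 := Real.sqrt_le_sqrt (h r hr)
    rw [Real.sqrt_mul (by linarith)] at h1
    rw [inv_mul_le_iff₀ (by positivity)]
    linarith
  have hC0 : 0 < √C := Real.sqrt_pos.2 (by linarith)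
  refine ⟨ν, ⟨hnn, ?_, fun r hr => ?_⟩, (2 * √C)⁻¹, 1, by positivity, one_pos, fun r hr => ?_⟩
  · rw [integrableOn_Ico_iff_integrableOn_Ioo]
    exact hint.mono_set Ioo_subset_Ioc_self
  · rw [htail r hr]
    exact (mul_pos (by positivity) (Real.sqrt_pos.2 (hω.tail_pos r hr))).trans_le (hlow r hr)
  · rw [htail r hr, one_mul]
    exact ⟨hlow r hr, hω.sqrtTailAverage_le hr⟩

/-! ### Integral means of the derivative of the kernel. -/

/-- The Taylor coefficients of `(1 - w) Φ'(w)`. -/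
noncomputable def _root_.kernelDerivDiff (ω : ℝ → ℝ) (n : ℕ) : ℝ :=
  (n + 1) * kernelCoeff ω (n + 1) - n * kernelCoeff ω n

theorem exists_abs_kernelDerivDiff_le (hω : IsRadialWeight ω) (hup : UpperDoubling ω) :
    ∃ D : ℝ, 0 < D ∧ ∀ n, |kernelDerivDiff ω n| ≤ D * kernelCoeff ω (n + 1) := by
  obtain ⟨D, hD, h⟩ := hω.exists_natCast_mul_radialMoment_sub_le hup
  refine ⟨1 + D, by positivity, fun n => ?_⟩
  have h1 := hω.radialMoment_pos (2 * n + 1)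
  have h3 := hω.radialMoment_pos (2 * n + 3)
  have hle := hω.radialMoment_anti (show 2 * n + 1 ≤ 2 * n + 3 by omega)
  -- Factoring out the next coefficient leaves exactly the moment difference controlled by doubling.
  have e : kernelDerivDiff ω n = (1 + n * (radialMoment ω (2 * n + 1) - radialMoment ω (2 * n + 3)) /
      radialMoment ω (2 * n + 1)) * kernelCoeff ω (n + 1) := by
    rw [kernelDerivDiff, kernelCoeff, kernelCoeff, show 2 * (n + 1) + 1 = 2 * n + 3 by ring]
    field_simp
    ring
  have hc := (hω.kernelCoeff_pos (n + 1)).le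
  have hq : n * (radialMoment ω (2 * n + 1) - radialMoment ω (2 * n + 3)) /
      radialMoment ω (2 * n + 1) ≤ D := (div_le_iff₀ h1).2 (h n)
  have hq0 : 0 ≤ n * (radialMoment ω (2 * n + 1) - radialMoment ω (2 * n + 3)) /
      radialMoment ω (2 * n + 1) :=
    div_nonneg (mul_nonneg (by positivity) (by linarith)) h1.le
  rw [e, abs_of_nonneg (by positivity)]
  gcongr

theorem hasSum_kernelDerivDiff (hω : IsRadialWeight ω) {w : ℂ} (hw : w ∈ disc) :
    HasSum (fun n => (kernelDerivDiff ω n : ℂ) * w ^ n) ((1 - w) * deriv (kernelSeries ω) w) := by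
  have h1 := hω.hasSum_deriv_kernelSeries hw
  have h2 : HasSum (fun n : ℕ => (n * kernelCoeff ω n : ℂ) * w ^ n)
      (w * deriv (kernelSeries ω) w) := by
    refine (hasSum_nat_add_iff' 1).1 ?_
    convert! h1.mul_left w using 1
    · ext n
      push_cast
      ring
    · simp
  convert! h1.sub h2 using 1
  · ext n
    rw [kernelDerivDiff]
    push_cast
    ring
  · ring

theorem exists_tsum_kernelCoeff_sq_le (hω : IsRadialWeight ω) (hup : UpperDoubling ω) :
    ∃ B : ℝ, 0 < B ∧ ∀ x ∈ Ico (0 : ℝ) 1, ∀ F : Finset ℕ,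
      ∑ n ∈ F, (kernelCoeff ω (n + 1) * x ^ n) ^ 2 ≤ B / ((1 - x) * tail ω x ^ 2) := by
  obtain ⟨C, hC, h⟩ := hω.exists_doubling hup
  have hC0 : 0 < C := by linarith
  refine ⟨2 * C ^ 4, by positivity, fun x hx F => ?_⟩
  have hx0 := hx.1
  have hx1 : 0 < 1 - x := by linarith [hx.2]
  -- Two doubling steps, so that `t^4 ≥ x` by Bernoulli. One factor `x^n` then absorbs the growth
  -- `t^(-4n)` of the squared coefficient, and the other sums to `1/(1-x)`.
  obtain ⟨t, ht⟩ : ∃ t, t = 1 - (1 - x) / 2 ^ 2 := ⟨_, rfl⟩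
  have ht0 : 3 / 4 ≤ t := by rw [ht]; linarith
  have ht1 : t < 1 := by rw [ht]; linarith
  have hgt := hω.tail_pos t ⟨by linarith, ht1⟩
  have hgx := hω.tail_pos x hx
  have hg : tail ω x ≤ C ^ 2 * tail ω t := by
    rw [ht]; exact tail_le_pow_mul hC h 2 hx
  have ht4 : x ≤ t ^ 4 := by
    have := one_add_mul_le_pow (a := -((1 - x) / 2 ^ 2)) (by linarith) 4
    rw [← sub_eq_add_neg, ← ht] at this
    refine le_trans (le_of_eq ?_) this
    push_cast
    ring
  have ht6 : 1 / 8 ≤ t ^ 6 := by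
    calc (1 : ℝ) / 8 ≤ (3 / 4) ^ 6 := by norm_num
      _ ≤ _ := by gcongr
  have htpos : 0 < t := by linarith
  have hterm : ∀ n, (kernelCoeff ω (n + 1) * x ^ n) ^ 2 ≤ 2 / tail ω t ^ 2 * x ^ n := fun n => by
    have hc := hω.kernelCoeff_le (n + 1) (t := t) ⟨htpos, ht1⟩
    have hcp := (hω.kernelCoeff_pos (n + 1)).le
    calc (kernelCoeff ω (n + 1) * x ^ n) ^ 2
        ≤ ((2 * (t ^ (2 * (n + 1) + 1) * tail ω t))⁻¹ * x ^ n) ^ 2 := by gcongr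
      _ = (x ^ n / (t ^ 4) ^ n) * (1 / (4 * t ^ 6 * tail ω t ^ 2)) * x ^ n := by
          field_simp
          ring
      _ ≤ 1 * (2 / tail ω t ^ 2) * x ^ n := by
          gcongr ?_ * ?_ * _
          · rw [div_le_one (by positivity)]
            gcongr
          · rw [div_le_div_iff₀ (by positivity) (by positivity)]
            nlinarith [sq_nonneg (tail ω t)]
      _ = _ := by rw [one_mul]
  calc _ ≤ ∑ n ∈ F, 2 / tail ω t ^ 2 * x ^ n := Finset.sum_le_sum fun n _ => hterm n
    _ ≤ 2 / tail ω t ^ 2 * (1 - x)⁻¹ :=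
        sum_le_hasSum F (fun n _ => by positivity)
          ((hasSum_geometric_of_lt_one hx0 hx.2).mul_left _)
    _ ≤ _ := by
        rw [← div_eq_mul_inv, div_div, div_le_div_iff₀ (by positivity) (by positivity)]
        have : tail ω x ^ 2 ≤ (C ^ 2 * tail ω t) ^ 2 := by gcongr
        calc 2 * ((1 - x) * tail ω x ^ 2) ≤ 2 * ((1 - x) * (C ^ 2 * tail ω t) ^ 2) := by gcongr
          _ = _ := by ring

theorem continuousOn_deriv_kernelSeries (hω : IsRadialWeight ω) :
    ContinuousOn (deriv (kernelSeries ω)) disc :=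
  (hω.differentiableOn_kernelSeries.deriv isOpen_disc).continuousOn

theorem _root_.norm_mul_exp_neg (u : ℂ) (θ : ℝ) : ‖u * Complex.exp (-(θ * Complex.I))‖ = ‖u‖ := by
  rw [← neg_mul, ← Complex.ofReal_neg, norm_mul, Complex.norm_exp_ofReal_mul_I, mul_one]

/-- The integral means of the derivative of the Bergman kernel. -/
theorem exists_integral_norm_deriv_kernelSeries_le (hω : IsRadialWeight ω)
    (hup : UpperDoubling ω) : ∃ B : ℝ, 0 < B ∧ ∀ u ∈ disc,
      ∫ θ in Ioo (-Real.pi) Real.pi,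
        ‖deriv (kernelSeries ω) (u * Complex.exp (-(θ * Complex.I)))‖ ≤
      B / ((1 - ‖u‖) * tail ω ‖u‖) := by
  obtain ⟨D, hD, hDn⟩ := hω.exists_abs_kernelDerivDiff_le hup
  obtain ⟨B, hB, hBx⟩ := hω.exists_tsum_kernelCoeff_sq_le hup
  refine ⟨Real.pi * (D ^ 2 * B + 1), by positivity, fun u hu => ?_⟩
  have hx := norm_mem_Ico hu
  set x := ‖u‖ with hxdef
  have hx0 := hx.1
  have hx1 : 0 < 1 - x := by linarith [hx.2]
  set g := tail ω x with hg
  have hgp : 0 < g := hω.tail_pos x hx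
  have hw : ∀ θ : ℝ, u * Complex.exp (-(θ * Complex.I)) ∈ disc := fun θ => by
    rw [mem_disc, norm_mul_exp_neg]; exact hx.2
  have hwne : ∀ θ : ℝ, 1 - u * Complex.exp (-(θ * Complex.I)) ≠ 0 := fun θ h => by
    have := mem_disc.1 (hw θ)
    rw [← sub_eq_zero.1 h, norm_one] at this
    exact lt_irrefl _ this
  have hpow : ∀ (a : ℕ → ℂ) (θ : ℝ) (n : ℕ), a n * (u * Complex.exp (-(θ * Complex.I))) ^ n =
      a n * u ^ n * Complex.exp (-(n * θ * Complex.I)) := fun a θ n => by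
    rw [mul_pow, ← Complex.exp_nat_mul, mul_assoc]
    congr 3
    ring
  have hcD : Continuous fun θ : ℝ => deriv (kernelSeries ω) (u * Complex.exp (-(θ * Complex.I))) :=
    hω.continuousOn_deriv_kernelSeries.comp_continuous (by fun_prop) hw
  have hI1 : ∫ θ in Ioo (-Real.pi) Real.pi, ‖(1 - u * Complex.exp (-(θ * Complex.I))) *
      deriv (kernelSeries ω) (u * Complex.exp (-(θ * Complex.I)))‖ ^ 2 ≤
      2 * Real.pi * (D ^ 2 * (B / ((1 - x) * g ^ 2))) := by
    have hs := (hω.hasSum_kernelDerivDiff hu).summable.norm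
    have hP := hasSum_norm_sq_trig hs
    have e : ∀ θ : ℝ, (1 - u * Complex.exp (-(θ * Complex.I))) *
      deriv (kernelSeries ω) (u * Complex.exp (-(θ * Complex.I))) =
      ∑' n : ℕ, (kernelDerivDiff ω n : ℂ) * u ^ n * Complex.exp (-(n * θ * Complex.I)) := fun θ => by
      rw [← (hω.hasSum_kernelDerivDiff (hw θ)).tsum_eq]
      simp_rw [hpow (fun n => (kernelDerivDiff ω n : ℂ)) θ]
    simp_rw [e]
    refine hasSum_le_of_sum_le hP fun F => ?_
    rw [← Finset.mul_sum]
    have h1 : ∀ n, ‖(kernelDerivDiff ω n : ℂ) * u ^ n‖ ^ 2 ≤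
        D ^ 2 * (kernelCoeff ω (n + 1) * x ^ n) ^ 2 := fun n => by
      rw [norm_mul, norm_pow, Complex.norm_real, Real.norm_eq_abs, ← mul_pow, ← mul_assoc]
      have := hDn n
      gcongr
    calc _ ≤ 2 * Real.pi * ∑ n ∈ F, D ^ 2 * (kernelCoeff ω (n + 1) * x ^ n) ^ 2 := by
          gcongr with n hn
          exact h1 n
      _ ≤ _ := by
          rw [← Finset.mul_sum]
          gcongr
          exact hBx x hx F
  have hI2 : ∫ θ in Ioo (-Real.pi) Real.pi, ‖(1 - u * Complex.exp (-(θ * Complex.I)))⁻¹‖ ^ 2 ≤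
      2 * Real.pi * (1 - x)⁻¹ := by
    have hs : Summable fun n : ℕ => ‖(1 : ℂ) * u ^ n‖ := by
      simp only [one_mul, norm_pow]
      exact summable_geometric_of_lt_one hx0 hx.2
    have hP := hasSum_norm_sq_trig hs
    have e : ∀ θ : ℝ, (1 - u * Complex.exp (-(θ * Complex.I)))⁻¹ =
      ∑' n : ℕ, (1 : ℂ) * u ^ n * Complex.exp (-(n * θ * Complex.I)) := fun θ => by
      rw [← tsum_geometric_of_norm_lt_one (mem_disc.1 (hw θ))]
      congr 1 with n
      rw [← hpow (fun _ => 1) θ, one_mul]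
    simp_rw [e]
    refine hasSum_le_of_sum_le hP fun F => ?_
    rw [← Finset.mul_sum]
    gcongr
    refine le_trans (Finset.sum_le_sum fun n _ => ?_) (sum_le_hasSum F (fun n _ => by positivity)
      (hasSum_geometric_of_lt_one hx0 hx.2))
    rw [one_mul, norm_pow, ← hxdef]
    exact pow_le_of_le_one (by positivity) (pow_le_one₀ hx0 hx.2.le) two_ne_zero
  have hc1 : Continuous fun θ : ℝ => ‖(1 - u * Complex.exp (-(θ * Complex.I))) *
      deriv (kernelSeries ω) (u * Complex.exp (-(θ * Complex.I)))‖ ^ 2 := by fun_prop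
  have hc2 : Continuous fun θ : ℝ => ‖(1 - u * Complex.exp (-(θ * Complex.I)))⁻¹‖ ^ 2 :=
    ((Continuous.inv₀ (by fun_prop) hwne).norm).pow 2
  -- Cauchy-Schwarz in the form `a b ≤ (g/2) a^2 + b^2/(2g)`. The weight `g = ω̂(x)` balances the
  -- two Parseval bounds, both becoming of order `1/((1-x) g)`.
  calc _ ≤ ∫ θ in Ioo (-Real.pi) Real.pi, (g / 2 * ‖(1 - u * Complex.exp (-(θ * Complex.I))) *
        deriv (kernelSeries ω) (u * Complex.exp (-(θ * Complex.I)))‖ ^ 2 +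
        1 / (2 * g) * ‖(1 - u * Complex.exp (-(θ * Complex.I)))⁻¹‖ ^ 2) := by
        refine setIntegral_mono (integrableOn_Ioo_of_continuous hcD.norm _ _)
          ((integrableOn_Ioo_of_continuous hc1 _ _).const_mul _ |>.add
            ((integrableOn_Ioo_of_continuous hc2 _ _).const_mul _)) fun θ => ?_
        set p := 1 - u * Complex.exp (-(θ * Complex.I)) with hp
        set q := deriv (kernelSeries ω) (u * Complex.exp (-(θ * Complex.I)))
        have hpp : 0 < ‖p‖ := norm_pos_iff.2 (hwne θ)
        simp only [norm_mul, norm_inv]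
        have e : ‖q‖ = (‖p‖ * ‖q‖) * ‖p‖⁻¹ := by field_simp
        have h2 : g / 2 * (‖p‖ * ‖q‖) ^ 2 + 1 / (2 * g) * ‖p‖⁻¹ ^ 2 - (‖p‖ * ‖q‖) * ‖p‖⁻¹ =
            (g * (‖p‖ * ‖q‖) - ‖p‖⁻¹) ^ 2 / (2 * g) := by
          field_simp
          ring
        have h3 : 0 ≤ (g * (‖p‖ * ‖q‖) - ‖p‖⁻¹) ^ 2 / (2 * g) := by positivity
        linarith
    _ ≤ g / 2 * (2 * Real.pi * (D ^ 2 * (B / ((1 - x) * g ^ 2)))) +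
        1 / (2 * g) * (2 * Real.pi * (1 - x)⁻¹) := by
        rw [integral_add ((integrableOn_Ioo_of_continuous hc1 _ _).const_mul _)
          ((integrableOn_Ioo_of_continuous hc2 _ _).const_mul _), integral_const_mul,
          integral_const_mul]
        gcongr
    _ = _ := by
        field_simp

end IsRadialWeight

/-! ### The substitution `u = ω̂(r)`. -/

namespace IsRadialWeight

variable {ω ν : ℝ → ℝ}

theorem lintegral_Ioo_eq_tail_sub (hω : IsRadialWeight ω) {a : ℝ} (ha : a ∈ Icc (0 : ℝ) 1) :
    ∫⁻ r in Ioo a 1, ENNReal.ofReal (ω r) = ENNReal.ofReal (tail ω a) := by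
  rw [tail, intervalIntegral.integral_of_le ha.2, integral_Ioc_eq_integral_Ioo,
    ofReal_integral_eq_lintegral_ofReal]
  · exact hω.integrableOn_Ioo.mono_set (Ioo_subset_Ioo_left ha.1)
  · exact (ae_restrict_iff' measurableSet_Ioo).2
      (.of_forall fun x hx => hω.nonneg x ⟨ha.1.trans hx.1.le, hx.2⟩)

/-- For `0 < u < ω̂(0)` the sublevel set is an interval `[c, 1)` with `ω̂(c) = u`, whose mass is
`u`. -/
theorem lintegral_tail_le (hω : IsRadialWeight ω) (u : ℝ) :
    ∫⁻ r in {r | tail ω r ≤ u} ∩ Ioo 0 1, ENNReal.ofReal (ω r) =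
      ENNReal.ofReal (min u (tail ω 0)) := by
  have h00 : (0 : ℝ) ∈ Icc (0 : ℝ) 1 := by simp
  rcases le_or_gt (tail ω 0) u with hu | hu
  · have : {r | tail ω r ≤ u} ∩ Ioo (0 : ℝ) 1 = Ioo 0 1 :=
      inter_eq_right.2 fun r hr => (hω.tail_anti le_rfl hr.1.le hr.2.le).trans hu
    rw [this, hω.lintegral_Ioo_eq_tail_sub h00, min_eq_right hu]
  rw [min_eq_left hu.le]
  rcases le_or_gt u 0 with hu0 | hu0
  · have : {r | tail ω r ≤ u} ∩ Ioo (0 : ℝ) 1 = ∅ := by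
      ext r
      simp only [mem_inter_iff, mem_empty_iff_false, iff_false]
      exact fun h => absurd ((h.1 : tail ω r ≤ u).trans hu0)
        (not_le.2 (hω.tail_pos r (Ioo_subset_Ico_self h.2)))
    rw [this, ENNReal.ofReal_of_nonpos hu0]
    simp
  · have hS : IsCompact (Icc (0 : ℝ) 1 ∩ tail ω ⁻¹' Iic u) :=
      isCompact_Icc.of_isClosed_subset
        (hω.continuousOn_tail.preimage_isClosed_of_isClosed isClosed_Icc isClosed_Iic)
        inter_subset_left
    -- The tail may be constant on intervals where `ω` vanishes, so the least point of the level is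
    -- taken.
    obtain ⟨a, ⟨haI, hau⟩, hmin⟩ := hS.exists_isLeast
      ⟨1, by simp, by rw [mem_preimage, tail_one]; exact hu0.le⟩
    obtain ⟨c, hc, hcu⟩ := intermediate_value_Icc' haI.1
      (hω.continuousOn_tail.mono (Icc_subset_Icc_right haI.2)) ⟨hau, hu.le⟩
    have hca : c = a := le_antisymm hc.2 (hmin ⟨⟨hc.1, hc.2.trans haI.2⟩, hcu.le⟩)
    subst hca
    have hc0 : 0 < c := lt_of_le_of_ne haI.1 fun h => by
      rw [← h] at hcu
      exact hu.ne' hcu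
    have : {r | tail ω r ≤ u} ∩ Ioo (0 : ℝ) 1 = Ico c 1 := by
      ext r
      constructor
      · exact fun h => ⟨hmin ⟨Ioo_subset_Icc_self h.2, h.1⟩, h.2.2⟩
      · exact fun h => ⟨(hω.tail_anti haI.1 h.1 h.2.le).trans hcu.le, hc0.trans_le h.1, h.2⟩
    rw [this, setLIntegral_congr Ioo_ae_eq_Ico.symm, hω.lintegral_Ioo_eq_tail_sub haI, hcu]

/-- The tail of a radial weight transports the weight to Lebesgue measure. -/
theorem map_tail_withDensity (hω : IsRadialWeight ω) :
    Measure.map (tail ω) ((volume.restrict (Ioo 0 1)).withDensity fun r => ENNReal.ofReal (ω r)) =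
      volume.restrict (Ioc 0 (tail ω 0)) := by
  have hm : AEMeasurable (tail ω)
      ((volume.restrict (Ioo 0 1)).withDensity fun r => ENNReal.ofReal (ω r)) :=
    ((hω.continuousOn_tail.mono Ioo_subset_Icc_self).aemeasurable measurableSet_Ioo).mono_ac
      (withDensity_absolutelyContinuous _ _)
  have hval : ∀ u, Measure.map (tail ω) ((volume.restrict (Ioo 0 1)).withDensity
      fun r => ENNReal.ofReal (ω r)) (Iic u) = ENNReal.ofReal (min u (tail ω 0)) := fun u => by
    rw [Measure.map_apply_of_aemeasurable hm measurableSet_Iic, withDensity_apply',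
      Measure.restrict_restrict' measurableSet_Ioo]
    exact hω.lintegral_tail_le u
  have hfin : IsFiniteMeasure (volume.restrict (Ioc 0 (tail ω 0))) :=
    isFiniteMeasure_restrict.2 measure_Ioc_lt_top.ne
  symm
  refine Measure.ext_of_Iic _ _ fun u => ?_
  rw [hval, Measure.restrict_apply measurableSet_Iic]
  have : Iic u ∩ Ioc 0 (tail ω 0) = Ioc 0 (min u (tail ω 0)) := by
    ext x
    simp only [mem_inter_iff, mem_Iic, mem_Ioc, le_min_iff]
    tauto
  rw [this, Real.volume_Ioc, sub_zero]

/-- Change of variables through the pushforward of `ω dr`; it needs neither differentiability nor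
injectivity of the tail. -/
theorem lintegral_comp_tail (hω : IsRadialWeight ω) {φ : ℝ → ℝ≥0∞} (hφ : Measurable φ) :
    ∫⁻ r in Ioo 0 1, ENNReal.ofReal (ω r) * φ (tail ω r) =
      ∫⁻ u in Ioc 0 (tail ω 0), φ u := by
  have hm : AEMeasurable (tail ω)
      ((volume.restrict (Ioo 0 1)).withDensity fun r => ENNReal.ofReal (ω r)) :=
    ((hω.continuousOn_tail.mono Ioo_subset_Icc_self).aemeasurable measurableSet_Ioo).mono_ac
      (withDensity_absolutelyContinuous _ _)
  have hmt : AEMeasurable (tail ω) (volume.restrict (Ioo 0 1)) :=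
    (hω.continuousOn_tail.mono Ioo_subset_Icc_self).aemeasurable measurableSet_Ioo
  rw [← hω.map_tail_withDensity, lintegral_map' hφ.aemeasurable hm]
  change _ = ∫⁻ r, (φ ∘ tail ω) r ∂_
  rw [lintegral_withDensity_eq_lintegral_mul₀ hω.integrableOn_Ioo.aemeasurable.ennreal_ofReal
      (hφ.comp_aemeasurable hmt)]
  rfl

theorem _root_.lintegral_Ioc_rpow_neg_half {v : ℝ} (hv : 0 ≤ v) :
    ∫⁻ u in Ioc 0 v, ENNReal.ofReal (u ^ (-(1 / 2) : ℝ)) = ENNReal.ofReal (2 * √v) := by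
  have hi := intervalIntegral.intervalIntegrable_rpow' (a := 0) (b := v) (r := -(1 / 2))
    (by norm_num)
  rw [← ofReal_integral_eq_lintegral_ofReal ((intervalIntegrable_iff_integrableOn_Ioc_of_le hv).1 hi)
    ((ae_restrict_iff' measurableSet_Ioc).2 (.of_forall fun x hx => Real.rpow_nonneg hx.1.le _)),
    ← intervalIntegral.integral_of_le hv, integral_rpow (by norm_num), Real.sqrt_eq_rpow]
  congr 1
  norm_num
  ring

theorem _root_.lintegral_Ioi_rpow_neg_three_halves {v : ℝ} (hv : 0 < v) :
    ∫⁻ u in Ioi v, ENNReal.ofReal (u ^ (-(3 / 2) : ℝ)) = ENNReal.ofReal (2 / √v) := by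
  rw [← ofReal_integral_eq_lintegral_ofReal (integrableOn_Ioi_rpow_of_lt (by norm_num) hv)
    ((ae_restrict_iff' measurableSet_Ioi).2
      (.of_forall fun x hx => Real.rpow_nonneg (hv.trans hx).le _)),
    integral_Ioi_rpow_of_lt (by norm_num) hv, Real.sqrt_eq_rpow]
  congr 1
  rw [show (-(3 / 2) + 1 : ℝ) = -(1 / 2) by norm_num, Real.rpow_neg hv.le]
  field_simp

theorem _root_.rpow_neg_half_eq {u : ℝ} (hu : 0 < u) : u ^ (-(1 / 2) : ℝ) = (√u)⁻¹ := by
  rw [Real.rpow_neg hu.le, Real.sqrt_eq_rpow]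

theorem _root_.rpow_neg_three_halves_eq {u : ℝ} (hu : 0 < u) :
    u ^ (-(3 / 2) : ℝ) = (√u)⁻¹ / u := by
  rw [← rpow_neg_half_eq hu, show (-(3 / 2) : ℝ) = -(1 / 2) - 1 by norm_num, Real.rpow_sub_one hu.ne']

theorem ofReal_mul_tail (hω : IsRadialWeight ω) (φ : ℝ → ℝ) :
    ∫⁻ r in Ioo 0 1, ENNReal.ofReal (ω r * φ (tail ω r)) =
      ∫⁻ r in Ioo 0 1, ENNReal.ofReal (ω r) * ENNReal.ofReal (φ (tail ω r)) :=
  setLIntegral_congr_fun measurableSet_Ioo fun r hr =>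
    ENNReal.ofReal_mul (hω.nonneg r (Ioo_subset_Ico_self hr))

/-- The substitution gives `∫ u^(-1/2) du` over a bounded interval. This is why the projection is
defined on the whole growth space. -/
theorem integrableOn_div_sqrt_tail (hω : IsRadialWeight ω) :
    IntegrableOn (fun r => ω r * (√(tail ω r))⁻¹) (Ioo 0 1) := by
  have hmt : AEMeasurable (tail ω) (volume.restrict (Ioo 0 1)) :=
    (hω.continuousOn_tail.mono Ioo_subset_Icc_self).aemeasurable measurableSet_Ioo
  refine ⟨(hω.integrableOn_Ioo.aemeasurable.mul hmt.sqrt.inv).aestronglyMeasurable, ?_⟩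
  rw [hasFiniteIntegral_iff_ofReal]
  · rw [hω.ofReal_mul_tail fun u => (√u)⁻¹,
      hω.lintegral_comp_tail (φ := fun u => ENNReal.ofReal (√u)⁻¹) (by fun_prop),
      setLIntegral_congr_fun measurableSet_Ioc (g := fun u => ENNReal.ofReal (u ^ (-(1 / 2) : ℝ)))
        fun u hu => by simp only [rpow_neg_half_eq hu.1],
      lintegral_Ioc_rpow_neg_half (hω.tail_pos 0 (by simp)).le]
    exact ENNReal.ofReal_lt_top
  · exact (ae_restrict_iff' measurableSet_Ioo).2 (.of_forall fun x hx =>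
      mul_nonneg (hω.nonneg x (Ioo_subset_Ico_self hx)) (inv_nonneg.2 (Real.sqrt_nonneg _)))

/-- After the substitution, splitting at `v` leaves `v⁻¹ ∫_0^v u^(-1/2)` and `∫_v^∞ u^(-3/2)`, each
equal to `2/√v`. -/
theorem integral_div_sqrt_tail_div_max_le (hω : IsRadialWeight ω) {v : ℝ} (hv : 0 < v) :
    IntegrableOn (fun r => ω r * ((√(tail ω r))⁻¹ / max (tail ω r) v)) (Ioo 0 1) ∧
    ∫ r in Ioo 0 1, ω r * ((√(tail ω r))⁻¹ / max (tail ω r) v) ≤ 4 / √v := by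
  have hmt : AEMeasurable (tail ω) (volume.restrict (Ioo 0 1)) :=
    (hω.continuousOn_tail.mono Ioo_subset_Icc_self).aemeasurable measurableSet_Ioo
  have hnn : 0 ≤ᵐ[volume.restrict (Ioo 0 1)]
      fun r => ω r * ((√(tail ω r))⁻¹ / max (tail ω r) v) :=
    (ae_restrict_iff' measurableSet_Ioo).2 (.of_forall fun x hx =>
      mul_nonneg (hω.nonneg x (Ioo_subset_Ico_self hx))
        (div_nonneg (inv_nonneg.2 (Real.sqrt_nonneg _)) (hv.le.trans (le_max_right _ _))))
  have hmeas : AEStronglyMeasurable (fun r => ω r * ((√(tail ω r))⁻¹ / max (tail ω r) v))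
      (volume.restrict (Ioo 0 1)) :=
    (hω.integrableOn_Ioo.aemeasurable.mul
      (hmt.sqrt.inv.div (hmt.max aemeasurable_const))).aestronglyMeasurable
  have hs : 0 < √v := Real.sqrt_pos.2 hv
  have hle : ∫⁻ r in Ioo 0 1, ENNReal.ofReal (ω r * ((√(tail ω r))⁻¹ / max (tail ω r) v)) ≤
      ENNReal.ofReal (4 / √v) := by
    rw [hω.ofReal_mul_tail fun u => (√u)⁻¹ / max u v,
      hω.lintegral_comp_tail (φ := fun u => ENNReal.ofReal ((√u)⁻¹ / max u v)) (by fun_prop)]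
    calc _ ≤ ∫⁻ u in Ioc 0 v ∪ Ioi v, ENNReal.ofReal ((√u)⁻¹ / max u v) := by
          refine lintegral_mono_set fun u hu => ?_
          exact (le_or_gt u v).imp (fun h => ⟨hu.1, h⟩) id
      _ ≤ (∫⁻ u in Ioc 0 v, ENNReal.ofReal ((√u)⁻¹ / max u v)) +
          ∫⁻ u in Ioi v, ENNReal.ofReal ((√u)⁻¹ / max u v) := lintegral_union_le _ _ _
      _ = (∫⁻ u in Ioc 0 v, ENNReal.ofReal v⁻¹ * ENNReal.ofReal (u ^ (-(1 / 2) : ℝ))) +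
          ∫⁻ u in Ioi v, ENNReal.ofReal (u ^ (-(3 / 2) : ℝ)) := by
          congr 1
          · refine setLIntegral_congr_fun measurableSet_Ioc fun u hu => ?_
            simp only [rpow_neg_half_eq hu.1, max_eq_right hu.2]
            rw [← ENNReal.ofReal_mul (inv_pos.2 hv).le, div_eq_inv_mul]
          · refine setLIntegral_congr_fun measurableSet_Ioi fun u hu => ?_
            simp only [rpow_neg_three_halves_eq (hv.trans hu), max_eq_left (mem_Ioi.1 hu).le]
      _ = ENNReal.ofReal (v⁻¹ * (2 * √v) + 2 / √v) := by
          rw [lintegral_const_mul _ (by fun_prop), lintegral_Ioc_rpow_neg_half hv.le,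
            lintegral_Ioi_rpow_neg_three_halves hv, ← ENNReal.ofReal_mul (inv_pos.2 hv).le,
            ← ENNReal.ofReal_add (by positivity) (by positivity)]
      _ = _ := by
          congr 1
          have h2 : v = √v * √v := (Real.mul_self_sqrt hv.le).symm
          have h3 : v⁻¹ * (2 * √v) = 2 / √v := by
            rw [inv_mul_eq_div, div_eq_div_iff hv.ne' hs.ne', mul_assoc, ← h2]
          rw [h3]
          ring
  refine ⟨⟨hmeas, ?_⟩, ?_⟩
  · rw [hasFiniteIntegral_iff_ofReal hnn]
    exact hle.trans_lt ENNReal.ofReal_lt_top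
  · rw [integral_eq_lintegral_of_nonneg_ae hnn hmeas]
    exact ENNReal.toReal_le_of_le_ofReal (by positivity) hle

/-! ### Differentiation of the projection and the Bloch estimate. -/

theorem exists_norm_deriv_kernelSeries_le (hω : IsRadialWeight ω) {z : ℂ} (hz : z ∈ disc) :
    ∃ M : ℝ, ∀ w : ℂ, ‖w‖ ≤ ‖z‖ → ‖deriv (kernelSeries ω) w‖ ≤ M := by
  have hsub : Metric.closedBall (0 : ℂ) ‖z‖ ⊆ disc := fun w hw =>
    mem_disc.2 ((mem_closedBall_zero_iff.1 hw).trans_lt (mem_disc.1 hz))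
  obtain ⟨M, hM⟩ := (isCompact_closedBall (0 : ℂ) ‖z‖).exists_bound_of_continuousOn
    (hω.continuousOn_deriv_kernelSeries.mono hsub)
  exact ⟨M, fun w hw => hM w (mem_closedBall_zero_iff.2 hw)⟩

theorem continuousOn_deriv_kernelSeries_mul_conj (hω : IsRadialWeight ω) {z : ℂ} (hz : z ∈ disc) :
    ContinuousOn (fun ζ => deriv (kernelSeries ω) (z * conj ζ)) disc :=
  hω.continuousOn_deriv_kernelSeries.comp
    (by fun_prop) fun ζ hζ => mul_conj_mem_disc hz (mem_disc.1 hζ).le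

theorem hasDerivAt_integral_mul_kernelSeries (hω : IsRadialWeight ω) {G : ℂ → ℂ}
    (hG : Integrable G dA) {z : ℂ} (hz : z ∈ disc) :
    HasDerivAt (fun z => ∫ ζ, G ζ * kernelSeries ω (z * conj ζ) ∂dA)
      (∫ ζ, G ζ * (deriv (kernelSeries ω) (z * conj ζ) * conj ζ) ∂dA) z := by
  obtain ⟨h1, h2⟩ := mem_ball_midpoint hz
  -- On this larger ball `Φ'(w * conj ζ)` is bounded uniformly in `w` and `ζ`, which gives the
  -- dominating function.
  set ρ := (1 + ‖z‖) / 2 with hρ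
  have hρd : (ρ : ℂ) ∈ disc := by
    rw [mem_disc, Complex.norm_real, Real.norm_of_nonneg h1.1]; exact h1.2
  have hρn : ‖(ρ : ℂ)‖ = ρ := by rw [Complex.norm_real, Real.norm_of_nonneg h1.1]
  obtain ⟨M, hM⟩ := hω.exists_norm_deriv_kernelSeries_le hρd
  have hball : ∀ w ∈ Metric.ball (0 : ℂ) ρ, w ∈ disc := fun w hw =>
    mem_disc.2 ((mem_ball_zero_iff.1 hw).trans h1.2)
  refine (hasDerivAt_integral_of_dominated_loc_of_deriv_le
    (F := fun z ζ => G ζ * kernelSeries ω (z * conj ζ))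
    (F' := fun z ζ => G ζ * (deriv (kernelSeries ω) (z * conj ζ) * conj ζ))
    (bound := fun ζ => ‖G ζ‖ * M)
    (Metric.isOpen_ball.mem_nhds h2) ?_ (hω.integrable_mul_kernelSeries hG hz) ?_ ?_
    (hG.norm.mul_const M) ?_).2
  · filter_upwards [isOpen_disc.mem_nhds hz] with w hw
    exact (hω.integrable_mul_kernelSeries hG hw).aestronglyMeasurable
  · exact hG.aestronglyMeasurable.mul (aestronglyMeasurable_dA_of_continuousOn
      ((hω.continuousOn_deriv_kernelSeries_mul_conj hz).mul (by fun_prop)))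
  · filter_upwards [ae_dA_mem_disc] with ζ hζ w hw
    rw [norm_mul, norm_mul, RCLike.norm_conj]
    have h3 : ‖w * conj ζ‖ ≤ ‖(ρ : ℂ)‖ := by
      rw [hρn]; exact (norm_mul_conj_le hζ).trans (mem_ball_zero_iff.1 hw).le
    refine mul_le_mul_of_nonneg_left ?_ (norm_nonneg _)
    exact (mul_le_of_le_one_right (norm_nonneg _) (mem_disc.1 hζ).le).trans (hM _ h3)
  · filter_upwards [ae_dA_mem_disc] with ζ hζ w hw
    have h3 := (hω.differentiableOn_kernelSeries.differentiableAt
      (isOpen_disc.mem_nhds (mul_conj_mem_disc (hball w hw) (mem_disc.1 hζ).le))).hasDerivAt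
    have h4 := h3.comp w ((hasDerivAt_id w).mul_const (conj ζ))
    simpa using h4.const_mul (G ζ)

theorem hasDerivAt_bergmanProj (hω : IsRadialWeight ω) {f : ℂ → ℂ}
    (hf : Integrable (fun ζ => f ζ * (ω ‖ζ‖ : ℂ)) dA) {z : ℂ} (hz : z ∈ disc) :
    HasDerivAt (bergmanProj ω f)
      (∫ ζ, f ζ * (ω ‖ζ‖ : ℂ) * (deriv (kernelSeries ω) (z * conj ζ) * conj ζ) ∂dA) z :=
  (hω.hasDerivAt_integral_mul_kernelSeries hf hz).congr_of_eventuallyEq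
    (by filter_upwards [isOpen_disc.mem_nhds hz] with w hw using hω.bergmanProj_eq f hw)

/-- The weighted integral of the derivative of the Bergman kernel. -/
theorem exists_integral_div_sqrt_tail_mul_le (hω : IsRadialWeight ω) (hup : UpperDoubling ω) :
    ∃ B : ℝ, 0 < B ∧ ∀ z ∈ disc,
      Integrable (fun ζ => ω ‖ζ‖ * (√(tail ω ‖ζ‖))⁻¹ * ‖deriv (kernelSeries ω) (z * conj ζ)‖) dA ∧
      ∫ ζ, ω ‖ζ‖ * (√(tail ω ‖ζ‖))⁻¹ * ‖deriv (kernelSeries ω) (z * conj ζ)‖ ∂dA ≤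
        B / ((1 - ‖z‖) * √(tail ω ‖z‖)) := by
  obtain ⟨B, hB, hBu⟩ := hω.exists_integral_norm_deriv_kernelSeries_le hup
  refine ⟨Real.pi⁻¹ * (B * 4), by positivity, fun z hz => ?_⟩
  have hx := norm_mem_Ico hz
  have hx1 : 0 < 1 - ‖z‖ := by linarith [hx.2]
  have hgz := hω.tail_pos _ hx
  obtain ⟨M, hM⟩ := hω.exists_norm_deriv_kernelSeries_le hz
  have hI : Integrable
      (fun ζ => ω ‖ζ‖ * (√(tail ω ‖ζ‖))⁻¹ * ‖deriv (kernelSeries ω) (z * conj ζ)‖) dA := by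
    refine (integrable_dA_comp_norm hω.integrableOn_div_sqrt_tail).mul_bdd (c := M)
      (aestronglyMeasurable_dA_of_continuousOn
        (hω.continuousOn_deriv_kernelSeries_mul_conj hz)).norm ?_
    filter_upwards [ae_dA_mem_disc] with ζ hζ
    rw [norm_norm]
    exact hM _ (norm_mul_conj_le hζ)
  refine ⟨hI, ?_⟩
  obtain ⟨h1, h2⟩ := integral_dA_polar hI
  obtain ⟨h3, h4⟩ := hω.integral_div_sqrt_tail_div_max_le hgz
  rw [h2, smul_eq_mul]
  have hpt : ∀ r ∈ Ioo (0 : ℝ) 1, ∫ θ in Ioo (-Real.pi) Real.pi,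
      r • (ω ‖(r : ℂ) * Complex.exp (θ * Complex.I)‖ *
        (√(tail ω ‖(r : ℂ) * Complex.exp (θ * Complex.I)‖))⁻¹ *
        ‖deriv (kernelSeries ω) (z * conj ((r : ℂ) * Complex.exp (θ * Complex.I)))‖) ≤
      B / (1 - ‖z‖) * (ω r * ((√(tail ω r))⁻¹ / max (tail ω r) (tail ω ‖z‖))) := by
    intro r hr
    have hwr := hω.nonneg r (Ioo_subset_Ico_self hr)
    have hgr := hω.tail_pos r (Ioo_subset_Ico_self hr)
    have hconj : ∀ θ : ℝ, z * conj ((r : ℂ) * Complex.exp (θ * Complex.I)) =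
        (z * r) * Complex.exp (-(θ * Complex.I)) := fun θ => by
      rw [map_mul, Complex.conj_ofReal, ← Complex.exp_conj, mul_assoc]
      congr 3
      simp
    simp_rw [norm_ofReal_mul_exp hr.1.le, hconj, smul_eq_mul, ← mul_assoc]
    rw [integral_const_mul]
    have hn : ‖z * r‖ = ‖z‖ * r := by
      rw [norm_mul, Complex.norm_real, Real.norm_of_nonneg hr.1.le]
    have hle1 : ‖z‖ * r ≤ ‖z‖ := mul_le_of_le_one_right hx.1 hr.2.le
    have hle2 : ‖z‖ * r ≤ r := mul_le_of_le_one_left hr.1.le hx.2.le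
    have hzr0 : 0 ≤ ‖z‖ * r := mul_nonneg hx.1 hr.1.le
    have hb := hBu (z * r) (by rw [mem_disc, hn]; exact hle1.trans_lt hx.2)
    rw [hn] at hb
    -- The radius `|z| r` lies below both `r` and `|z|`, so the integral mean is decoupled into `1 -
    -- |z|` and a function of `ω̂(r)`.
    have hmax : max (tail ω r) (tail ω ‖z‖) ≤ tail ω (‖z‖ * r) :=
      max_le (hω.tail_anti hzr0 hle2 hr.2.le) (hω.tail_anti hzr0 hle1 hx.2.le)
    have hmp : 0 < max (tail ω r) (tail ω ‖z‖) := lt_max_of_lt_left hgr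
    have hb2 : B / ((1 - ‖z‖ * r) * tail ω (‖z‖ * r)) ≤
        B / ((1 - ‖z‖) * max (tail ω r) (tail ω ‖z‖)) := by
      have : 0 ≤ 1 - ‖z‖ * r := by linarith
      gcongr
    have hs : 0 ≤ (√(tail ω r))⁻¹ := by positivity
    calc _ ≤ 1 * ω r * (√(tail ω r))⁻¹ * (B / ((1 - ‖z‖) * max (tail ω r) (tail ω ‖z‖))) := by
          refine mul_le_mul ?_ (hb.trans hb2) (integral_nonneg fun _ => norm_nonneg _)
            (by positivity)
          have := hr.2.le
          gcongr
      _ = _ := by field_simp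
  calc _ ≤ Real.pi⁻¹ * ∫ r in Ioo (0 : ℝ) 1,
        B / (1 - ‖z‖) * (ω r * ((√(tail ω r))⁻¹ / max (tail ω r) (tail ω ‖z‖))) := by
        have := setIntegral_mono_on h1 (h3.const_mul (B / (1 - ‖z‖))) measurableSet_Ioo hpt
        have := Real.pi_pos
        gcongr
    _ ≤ Real.pi⁻¹ * (B / (1 - ‖z‖) * (4 / √(tail ω ‖z‖))) := by
        rw [integral_const_mul]
        have := Real.pi_pos
        gcongr
    _ = _ := by field_simp

/-- The Bergman projection is bounded into the weighted Bloch space with the square root weight. -/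
theorem bergmanBoundedToBloch (hω : IsRadialWeight ω) (hup : UpperDoubling ω)
    (hc : TailComparableSqrt ν ω) :
    BergmanBoundedToBloch ω (tail ν) := by
  obtain ⟨c, C, hc0, hC0, hcC⟩ := hc
  obtain ⟨B, hB, hBz⟩ := hω.exists_integral_div_sqrt_tail_mul_le hup
  refine ⟨⟨C * B / c, by positivity⟩, fun f hf => ?_⟩
  set N := (growthNorm (tail ν) f).toReal with hN
  have hN0 : 0 ≤ N := ENNReal.toReal_nonneg
  have hNe : growthNorm (tail ν) f = ENNReal.ofReal N := (ENNReal.ofReal_toReal hf.2.ne).symm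
  -- The lower comparison `c √ω̂ ≤ ν̂` dominates `f`; the upper one is used only for the weight in
  -- the Bloch norm, whence the constant `C B / c`.
  have hfN : ∀ᵐ ζ ∂dA, ‖f ζ * (ω ‖ζ‖ : ℂ)‖ ≤ N / c * (ω ‖ζ‖ * (√(tail ω ‖ζ‖))⁻¹) := by
    filter_upwards [ae_dA_mem_disc, ENNReal.ae_le_essSup (μ := dA)
      (fun z => ENNReal.ofReal (‖f z‖ * tail ν ‖z‖))] with ζ hζ h
    have h' : ENNReal.ofReal (‖f ζ‖ * tail ν ‖ζ‖) ≤ ENNReal.ofReal N := h.trans_eq hNe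
    rw [ENNReal.ofReal_le_ofReal_iff hN0] at h'
    have hx := norm_mem_Ico hζ
    have hw := hω.nonneg _ hx
    have hg := Real.sqrt_pos.2 (hω.tail_pos _ hx)
    have h1 : ‖f ζ‖ * (c * √(tail ω ‖ζ‖)) ≤ N :=
      (mul_le_mul_of_nonneg_left (hcC _ hx).1 (norm_nonneg _)).trans h'
    have h2 : ‖f ζ‖ ≤ N / (c * √(tail ω ‖ζ‖)) := (le_div_iff₀ (by positivity)).2 h1
    rw [norm_mul, Complex.norm_real, Real.norm_of_nonneg hw]
    calc _ ≤ N / (c * √(tail ω ‖ζ‖)) * ω ‖ζ‖ := by gcongr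
      _ = _ := by field_simp
  have hfi : Integrable (fun ζ => f ζ * (ω ‖ζ‖ : ℂ)) dA :=
    ((integrable_dA_comp_norm hω.integrableOn_div_sqrt_tail).const_mul (N / c)).mono'
      (hf.1.mul hω.integrable_weight_ofReal.aestronglyMeasurable) hfN
  have hbd : blochNorm (tail ν) (bergmanProj ω f) ≤ ENNReal.ofReal (C * B / c * N) := by
    refine iSup₂_le fun z hz => ENNReal.ofReal_le_ofReal ?_
    obtain ⟨hi, hle⟩ := hBz z hz
    have hx := norm_mem_Ico hz
    have hx1 : 0 < 1 - ‖z‖ := by linarith [hx.2]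
    have hg := Real.sqrt_pos.2 (hω.tail_pos _ hx)
    rw [(hω.hasDerivAt_bergmanProj hfi hz).deriv]
    have hn : ‖∫ ζ, f ζ * (ω ‖ζ‖ : ℂ) * (deriv (kernelSeries ω) (z * conj ζ) * conj ζ) ∂dA‖ ≤
        N / c * (B / ((1 - ‖z‖) * √(tail ω ‖z‖))) := by
      refine (norm_integral_le_of_norm_le (hi.const_mul (N / c)) ?_).trans ?_
      · filter_upwards [ae_dA_mem_disc, hfN] with ζ hζ h
        rw [norm_mul, norm_mul (deriv _ _), RCLike.norm_conj]
        have h1 : ‖deriv (kernelSeries ω) (z * conj ζ)‖ * ‖ζ‖ ≤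
            ‖deriv (kernelSeries ω) (z * conj ζ)‖ :=
          mul_le_of_le_one_right (norm_nonneg _) (mem_disc.1 hζ).le
        rw [← mul_assoc (N / c)]
        exact mul_le_mul h h1 (by positivity) ((norm_nonneg _).trans h)
      · rw [integral_const_mul]
        gcongr
    calc _ ≤ (1 - ‖z‖) * (C * √(tail ω ‖z‖)) * (N / c * (B / ((1 - ‖z‖) * √(tail ω ‖z‖)))) := by
          have := (hcC _ hx).2
          gcongr
      _ = _ := by field_simp
  refine ⟨hω.bergmanDefined_of_integrable hfi, ⟨fun z hz =>
    (hω.hasDerivAt_bergmanProj hfi hz).differentiableAt.differentiableWithinAt,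
    hbd.trans_lt ENNReal.ofReal_lt_top⟩, hbd.trans_eq ?_⟩
  rw [ENNReal.ofReal_mul (by positivity), hNe]
  congr 1
  exact ENNReal.ofReal_eq_coe_nnreal _

end IsRadialWeight

theorem mainTheorem11 (ω : ℝ → ℝ) (hω : IsRadialWeight ω)
    (hup : UpperDoubling ω) (hlow : ¬ LowerDoubling ω) :
    (∀ ν : ℝ → ℝ, IsRadialWeight ν → ¬ BergmanBoundedOnDomainToHardy ω (tail ν)) ∧
    (∃ ν : ℝ → ℝ, IsRadialWeight ν ∧ TailComparableSqrt ν ω) ∧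
    (∀ ν : ℝ → ℝ, IsRadialWeight ν → TailComparableSqrt ν ω →
      BergmanBoundedToBloch ω (tail ν)) :=
  ⟨fun _ hν => hω.not_bergmanBoundedOnDomainToHardy hup hlow hν, hω.exists_tailComparableSqrt hup,
    fun _ _ hc => hω.bergmanBoundedToBloch hup hc⟩
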